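/- Let $\mathbb T=\mathbb R/2\pi\mathbb Z$. For a real-valued distribution $u$ on $\mathbb T$ let $\widehat u(k)=\frac1{2\pi}\int_0^{2\pi}u(x)e^{-ikx}\,dx$ ($k\in\mathbb Z$) be its Fourier coefficients, let $P_0u=\frac1{2\pi}\int_0^{2\pi}u\,dx$ be its mean, regarded as a constant function, and for $s\in\mathbb R$ let $$\|u\|_{H^s}=(2\pi)^{1/2}\Big(\sum_{k\in\mathbb Z}(1+k^2)^{s}|\widehat u(k)|^2\Big)^{1/2}.$$ Let $H^s_0(\mathbb T)$ be the space of real-valued distributions $u$ on $\mathbb T$ with $\|u\|_{H^s}<\infty$ and $P_0u=0$, with this norm. Let $s\ge 1/2$, and let $M v := v_x+v^2-P_0(v^2)$ for $v\in H^s_0(\mathbb T)$, where $v_x$ is the distributional derivative and $v^2$ is the pointwise square of the function $v\in L^2(\mathbb T)$. Then $M$ is a bijection from $H^s_0(\mathbb T)$ onto $H^{s-1}_0(\mathbb T)$, and the inverse map $M^{-1}$ is locally Lipschitz from $H^{s-1}_0(\mathbb T)$ to $H^s_0(\mathbb T)$, in the sense that it is Lipschitz on every ball of $H^{s-1}_0(\mathbb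 T)$, with a Lipschitz constant that may depend on $s$ and on the ball. -/

import Mathlib

/-!
Real periodic distributions on the circle `𝕋 = ℝ / 2πℤ`, the mean-zero Sobolev spaces `H^s_0(𝕋)`,
and the Miura map `M v = v_x + v² - P₀(v²)`.
-/

namespace Miura

noncomputable section

open MeasureTheory
open scoped ContDiff

/-- Test functions on `𝕋`: smooth real functions on `ℝ` that are `2π`-periodic. -/
def TestFunction : Submodule ℝ (ℝ → ℝ) where
  carrier := {φ | ContDiff ℝ ∞ φ ∧ Function.Periodic φ (2 * Real.pi)}
  add_mem' hφ hψ := ⟨hφ.1.add hψ.1, hφ.2.add hψ.2⟩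
  zero_mem' := ⟨contDiff_const, fun _ => rfl⟩
  smul_mem' c φ hφ := ⟨contDiff_const.smul hφ.1, fun x => by simp [hφ.2 x]⟩

/-- The derivative as a linear map on test functions. -/
def TestFunction.deriv : TestFunction →ₗ[ℝ] TestFunction where
  toFun φ := ⟨_root_.deriv φ.1, (contDiff_infty_iff_deriv.1 φ.2.1).2, fun x => by
    rw [← deriv_comp_add_const]
    exact congrArg (fun f => _root_.deriv f x) (funext φ.2.2)⟩
  map_add' φ ψ := by
    ext x
    exact deriv_add (φ.2.1.differentiable (by simp) x) (ψ.2.1.differentiable (by simp) x)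
  map_smul' c φ := by
    ext x
    exact deriv_const_smul c (φ.2.1.differentiable (by simp) x)

/-- The test function `x ↦ cos (k x)`. -/
def TestFunction.cos (k : ℤ) : TestFunction :=
  ⟨fun x => Real.cos (k * x), by fun_prop, fun x => by
    show Real.cos (k * (x + 2 * Real.pi)) = Real.cos (k * x)
    rw [mul_add]; exact Real.cos_add_int_mul_two_pi _ k⟩

/-- The test function `x ↦ sin (k x)`. -/
def TestFunction.sin (k : ℤ) : TestFunction :=
  ⟨fun x => Real.sin (k * x), by fun_prop, fun x => by
    show Real.sin (k * (x + 2 * Real.pi)) = Real.sin (k * x)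
    rw [mul_add]; exact Real.sin_add_int_mul_two_pi _ k⟩

/-- Real distributions on `𝕋`: linear functionals on the test functions that are continuous, that is,
bounded by a constant times `max_{j ≤ N} sup_x |φ^{(j)}(x)|` for some `N`. -/
def Distribution : Submodule ℝ (TestFunction →ₗ[ℝ] ℝ) where
  carrier := {u | ∃ (N : ℕ) (C : ℝ), ∀ (φ : TestFunction) (B : ℝ),
    (∀ j ≤ N, ∀ x, |iteratedDeriv j φ.1 x| ≤ B) → |u φ| ≤ C * B}
  add_mem' := by
    rintro u v ⟨N, C, hu⟩ ⟨N', C', hv⟩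
    refine ⟨max N N', C + C', fun φ B h => ?_⟩
    have h1 := hu φ B fun j hj => h j (hj.trans (le_max_left _ _))
    have h2 := hv φ B fun j hj => h j (hj.trans (le_max_right _ _))
    have h3 := abs_add_le (u φ) (v φ)
    rw [LinearMap.add_apply, add_mul]
    linarith
  zero_mem' := ⟨0, 0, fun φ B _ => by simp⟩
  smul_mem' := by
    rintro c u ⟨N, C, hu⟩
    refine ⟨N, |c| * C, fun φ B h => ?_⟩
    rw [LinearMap.smul_apply, smul_eq_mul, abs_mul, mul_assoc]
    exact mul_le_mul_of_nonneg_left (hu φ B h) (abs_nonneg c)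

/-- The distributional derivative `⟨u_x, φ⟩ = -⟨u, φ_x⟩`. -/
def dx (u : Distribution) : Distribution :=
  ⟨-(u.1 ∘ₗ TestFunction.deriv), by
    obtain ⟨N, C, hu⟩ := u.2
    refine ⟨N + 1, C, fun φ B h => ?_⟩
    rw [LinearMap.neg_apply, abs_neg]
    refine hu _ B fun j hj x => ?_
    have := h (j + 1) (by omega) x
    rwa [iteratedDeriv_succ'] at this⟩

/-- The distribution `φ ↦ ∫_0^{2π} f φ` given by an integrable function `f` on the period. -/
def ofFun (f : ℝ → ℝ) (hf : IntegrableOn f (Set.Ioc 0 (2 * Real.pi))) :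
    Distribution :=
  have key (φ : TestFunction) :
      IntegrableOn (fun x => f x * φ.1 x) (Set.Ioc 0 (2 * Real.pi)) :=
    hf.mul_continuousOn_of_subset φ.2.1.continuous.continuousOn measurableSet_Ioc isCompact_Icc
      Set.Ioc_subset_Icc_self
  ⟨{ toFun := fun φ => ∫ x in Set.Ioc 0 (2 * Real.pi), f x * φ.1 x
     map_add' := fun φ ψ => by
       rw [← integral_add (key φ) (key ψ)]
       exact integral_congr_ae (ae_of_all _ fun x => mul_add _ _ _)
     map_smul' := fun c φ => by
       rw [RingHom.id_apply, smul_eq_mul, ← integral_const_mul]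
       exact integral_congr_ae (ae_of_all _ fun x => mul_left_comm _ _ _) },
   0, ∫ x in Set.Ioc 0 (2 * Real.pi), |f x|, fun φ B h => by
     rw [← integral_mul_const]
     refine abs_integral_le_integral_abs.trans
       (integral_mono (key φ).abs (hf.abs.mul_const B) fun x => ?_)
     have := h 0 le_rfl x
     rw [iteratedDeriv_zero] at this
     show |f x * φ.1 x| ≤ |f x| * B
     rw [abs_mul]
     exact mul_le_mul_of_nonneg_left this (abs_nonneg _)⟩

/-- Fourier coefficients `û(k) = (1/2π) ⟨u, e^{-ikx}⟩`. -/
def fourierCoeff (u : Distribution) (k : ℤ) : ℂ :=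
  (1 / (2 * Real.pi) : ℂ) *
    ((u.1 (TestFunction.cos k) : ℂ) - Complex.I * (u.1 (TestFunction.sin k) : ℂ))

/-- The mean operator `P₀ u = (1/2π) ∫_0^{2π} u`, as a constant function on `𝕋`
(`TestFunction.cos 0` is the constant function `1`). -/
def P0 (u : Distribution) : Distribution :=
  ofFun (fun _ => 1 / (2 * Real.pi) * u.1 (TestFunction.cos 0))
    (integrableOn_const measure_Ioc_lt_top.ne)

/-- `f` is a square-integrable function on the period that represents the distribution `v`. -/
def IsL2Rep (v : Distribution) (f : ℝ → ℝ) : Prop :=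
  MemLp f 2 (volume.restrict (Set.Ioc 0 (2 * Real.pi))) ∧
    ∀ φ : TestFunction, v.1 φ = ∫ x in Set.Ioc 0 (2 * Real.pi), f x * φ.1 x

open Classical in
/-- The pointwise square `v²` of a distribution `v` that is an `L²` function (such a function is
unique up to a null set); by convention `0` for all other distributions. -/
def sq (v : Distribution) : Distribution :=
  if h : ∃ f, IsL2Rep v f then
    ofFun (fun x => h.choose x ^ 2) h.choose_spec.1.integrable_sq
  else 0

/-- The Sobolev norm `‖u‖_{H^s} = (2π)^{1/2} ‖⟨k⟩^s û(k)‖_{ℓ²}`, where `⟨k⟩ = (1 + k²)^{1/2}`. -/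
def sobolevNorm (s : ℝ) (u : Distribution) : ℝ :=
  Real.sqrt (2 * Real.pi) *
    Real.sqrt (∑' k : ℤ, (Real.sqrt (1 + (k : ℝ) ^ 2) ^ s * ‖fourierCoeff u k‖) ^ 2)

/-- The space `H^s_0(𝕋)` of real distributions of finite `H^s` norm and of mean zero. -/
def SobolevZero (s : ℝ) : Set Distribution :=
  {u | Summable (fun k : ℤ => (Real.sqrt (1 + (k : ℝ) ^ 2) ^ s * ‖fourierCoeff u k‖) ^ 2) ∧
    P0 u = 0}

/-- The Miura map `M v = v_x + v² - P₀(v²)`. -/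
def miura (v : Distribution) : Distribution :=
  dx v + sq v - P0 (sq v)

end

end Miura

/-!
Applying the mean-zero antiderivative `∂⁻¹`, an isomorphism from `H^{s-1}_0` onto `H^s_0`, turns `M`
into the quadratic map `Q v = v + ∂⁻¹(v² - P₀(v²))`, which is first inverted on `L²_0`.

The difference `Q v - Q w` is `d + ∂⁻¹(a d - P₀(a d))` with `d = v - w` and `a = v + w`, and the
derivative of `Q` at `v` has the same form with `a = 2 v`. Setting `e = ∂⁻¹(a d - P₀(a d))` and
`g = d + e`, one gets the linear equation `e_x + a e = a g - P₀(a d)`, and its integrating factor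
`exp (∂⁻¹ a)` bounds `e`, hence `d`, by `g`, with a constant depending only on `‖a‖`. So
`d ↦ d + ∂⁻¹(a d - P₀(a d))` is bounded below, and invertible by continuation along `t a`,
`0 ≤ t ≤ 1`. Hence `Q` is an open map, and it is injective with a Lipschitz inverse on bounded sets
of `v`.

A bound on `g = Q v` bounds `v`: write `w = ∂⁻¹(v² - P₀(v²))` and test `w_x = v² - P₀(v²)` against
`φ²`, where `φ = exp (∂⁻¹ v)` satisfies `φ_x = v φ`. This gives
`∫ φ_x² + P₀(v²) ∫ φ² = 2 ∫ g φ φ_x`, and absorbing the right-hand side bounds `P₀(v²)` because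
`φ > 0`. Hence the range of `Q` is closed as well as open, and `Q` is onto.

For `v` and `w` in `H^σ`, `σ ≥ 0`, the Fourier coefficients of `v w` are `O(⟨k⟩^{-σ})`, so
`∂⁻¹(v w - P₀(v w))` lies in `H^{σ + 1/4}`. The bounds in `L²` therefore improve, a quarter of a
derivative at a time, to bounds in `H^s`.
-/

namespace Miura

section QuadraticMap

open Filter Topology

section LinearContinuation

variable {𝕜 E : Type*} [NontriviallyNormedField 𝕜] [NormedAddCommGroup E] [NormedSpace 𝕜 E]
  [CompleteSpace E]

theorem isUnit_of_bounded_below_of_norm_sub_lt {S T : E →L[𝕜] E} {C : ℝ} (hT : IsUnit T)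
    (hbelow : ∀ x, ‖x‖ ≤ C * ‖T x‖) (hsub : C * ‖S - T‖ < 1) : IsUnit S := by
  rcases subsingleton_or_nontrivial E with hE | hE
  · exact ⟨1, Subsingleton.elim _ _⟩
  obtain ⟨u, rfl⟩ := hT
  have hinv_apply (x : E) : ‖(↑u⁻¹ : E →L[𝕜] E) x‖ ≤ C * ‖x‖ := by
    have hux : (u : E →L[𝕜] E) ((↑u⁻¹ : E →L[𝕜] E) x) = x := congrArg (· x) u.mul_inv
    simpa only [hux] using hbelow ((↑u⁻¹ : E →L[𝕜] E) x)
  have hC : 0 ≤ C := by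
    obtain ⟨x, hx⟩ := exists_ne (0 : E)
    exact nonneg_of_mul_nonneg_left ((norm_nonneg _).trans (hinv_apply x)) (norm_pos_iff.2 hx)
  have hinv : ‖(↑u⁻¹ : E →L[𝕜] E)‖ ≤ C := ContinuousLinearMap.opNorm_le_bound _ hC hinv_apply
  refine ⟨Units.ofNearby u S ?_, rfl⟩
  rw [inv_eq_one_div, lt_div_iff₀' (norm_pos_iff.2 u⁻¹.ne_zero)]
  exact (mul_le_mul_of_nonneg_right hinv (norm_nonneg _)).trans_lt hsub

theorem isUnit_of_continuous_of_bounded_below {X : Type*} [TopologicalSpace X]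
    [PreconnectedSpace X] {P : X → E →L[𝕜] E} (hP : Continuous P) {C : ℝ}
    (hbelow : ∀ x v, ‖v‖ ≤ C * ‖P x v‖) {x₀ : X} (h₀ : IsUnit (P x₀)) (x : X) :
    IsUnit (P x) := by
  have hopen : IsOpen {y | IsUnit (P y)} := Units.isOpen.preimage hP
  have hclosed : IsClosed {y | IsUnit (P y)} := by
    refine isClosed_of_closure_subset fun y hy => ?_
    have hnear : ∀ᶠ z in 𝓝 y, C * ‖P y - P z‖ < 1 := by
      refine ContinuousAt.eventually_lt (by fun_prop) continuousAt_const ?_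
      simp
    obtain ⟨z, hz, hunit⟩ := mem_closure_iff_nhds.1 hy _ hnear
    exact isUnit_of_bounded_below_of_norm_sub_lt hunit (hbelow z) hz
  exact (IsClopen.eq_univ ⟨hclosed, hopen⟩ ⟨x₀, h₀⟩).ge (Set.mem_univ x)

end LinearContinuation

theorem isClosed_range_of_lipschitz_inverse {X Y : Type*} [MetricSpace X] [CompleteSpace X]
    [MetricSpace Y] {F : X → Y} (hF : Continuous F) (y₀ : Y)
    (hlip : ∀ R, ∃ L : ℝ, ∀ v w, dist (F v) y₀ ≤ R → dist (F w) y₀ ≤ R →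
      dist v w ≤ L * dist (F v) (F w)) : IsClosed (Set.range F) := by
  refine isClosed_of_closure_subset fun y hy => ?_
  obtain ⟨z, hz, hlim⟩ := mem_closure_iff_seq_limit.1 hy
  choose v hv using hz
  obtain rfl := funext hv
  obtain ⟨R, hR⟩ := (hlim.dist tendsto_const_nhds).bddAbove_range (a := dist y y₀)
  obtain ⟨L, hL⟩ := hlip R
  have hcauchy : CauchySeq v := by
    rw [cauchySeq_iff_tendsto_dist_atTop_0]
    have hFv := (cauchySeq_iff_tendsto_dist_atTop_0.1 hlim.cauchySeq).const_mul L
    rw [mul_zero] at hFv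
    exact squeeze_zero (fun _ => dist_nonneg) (fun n => hL _ _ (hR ⟨_, rfl⟩) (hR ⟨_, rfl⟩)) hFv
  obtain ⟨w, hw⟩ := cauchySeq_tendsto_of_complete hcauchy
  exact ⟨w, tendsto_nhds_unique ((hF.tendsto w).comp hw) hlim⟩

variable {E : Type*} [NormedAddCommGroup E] [NormedSpace ℝ E]

theorem isUnit_one_add_of_bounded_below [CompleteSpace E] (T : E →L[ℝ] E) (C : ℝ)
    (hbelow : ∀ t ∈ Set.Icc (0 : ℝ) 1, ∀ d, ‖d‖ ≤ C * ‖d + t • T d‖) : IsUnit (1 + T) := by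
  have := isUnit_of_continuous_of_bounded_below
    (P := fun t : Set.Icc (0 : ℝ) 1 => 1 + (t : ℝ) • T) (by fun_prop)
    (fun t v => hbelow t t.2 v) (x₀ := 0) (by simp) 1
  simpa using this

variable {B : E →L[ℝ] E →L[ℝ] E}

theorem quadratic_sub_quadratic (hB : ∀ a b, B a b = B b a) (v w : E) :
    (v + B v v) - (w + B w w) = (v - w) + B (v + w) (v - w) := by
  simp only [map_add, map_sub, _root_.add_apply]
  rw [hB w v]
  abel

theorem hasStrictFDerivAt_quadratic (hB : ∀ a b, B a b = B b a) (v : E) :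
    HasStrictFDerivAt (fun v => v + B v v) (1 + B (v + v)) v := by
  have hBv : HasStrictFDerivAt (fun v => B v v)
      (B.precompR E v (.id ℝ E) + B.precompL E (.id ℝ E) v) v :=
    B.hasStrictFDerivAt_of_bilinear (hasStrictFDerivAt_id v) (hasStrictFDerivAt_id v)
  refine ((hasStrictFDerivAt_id v).add hBv).congr_fderiv ?_
  ext d
  simp [hB d v]

theorem isUnit_one_add_of_linear_bounded_below [CompleteSpace E]
    (hlin : ∀ R : ℝ, ∃ C : ℝ, ∀ a d, ‖a‖ ≤ R → ‖d‖ ≤ C * ‖d + B a d‖) (a : E) :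
    IsUnit (1 + B a) := by
  obtain ⟨C, hC⟩ := hlin ‖a‖
  refine isUnit_one_add_of_bounded_below _ C fun t ht d => ?_
  have hta : ‖t • a‖ ≤ ‖a‖ := by
    rw [norm_smul, Real.norm_of_nonneg ht.1]
    exact mul_le_of_le_one_left (norm_nonneg a) ht.2
  simpa using hC (t • a) d hta

theorem isOpenMap_quadratic [CompleteSpace E] (hB : ∀ a b, B a b = B b a)
    (hlin : ∀ R : ℝ, ∃ C : ℝ, ∀ a d, ‖a‖ ≤ R → ‖d‖ ≤ C * ‖d + B a d‖) :
    IsOpenMap fun v => v + B v v := by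
  choose u hu using isUnit_one_add_of_linear_bounded_below hlin
  refine isOpenMap_of_hasStrictFDerivAt_equiv
    (f' := fun v => ContinuousLinearEquiv.unitsEquiv ℝ E (u (v + v))) fun v => ?_
  exact (hasStrictFDerivAt_quadratic hB v).congr_fderiv (hu (v + v)).symm

theorem exists_lipschitz_quadratic (hB : ∀ a b, B a b = B b a)
    (hlin : ∀ R : ℝ, ∃ C : ℝ, ∀ a d, ‖a‖ ≤ R → ‖d‖ ≤ C * ‖d + B a d‖)
    (hbdd : ∀ R : ℝ, ∃ K : ℝ, ∀ v, ‖v + B v v‖ ≤ R → ‖v‖ ≤ K) (R : ℝ) :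
    ∃ L : ℝ, ∀ v w, ‖v + B v v‖ ≤ R → ‖w + B w w‖ ≤ R →
      ‖v - w‖ ≤ L * ‖(v + B v v) - (w + B w w)‖ := by
  obtain ⟨K, hK⟩ := hbdd R
  obtain ⟨C, hC⟩ := hlin (K + K)
  refine ⟨C, fun v w hv hw => ?_⟩
  rw [quadratic_sub_quadratic hB]
  exact hC _ _ ((norm_add_le _ _).trans (add_le_add (hK v hv) (hK w hw)))

theorem surjective_quadratic [CompleteSpace E] (hB : ∀ a b, B a b = B b a)
    (hlin : ∀ R : ℝ, ∃ C : ℝ, ∀ a d, ‖a‖ ≤ R → ‖d‖ ≤ C * ‖d + B a d‖)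
    (hbdd : ∀ R : ℝ, ∃ K : ℝ, ∀ v, ‖v + B v v‖ ≤ R → ‖v‖ ≤ K) :
    Function.Surjective fun v => v + B v v := by
  have hclosed : IsClosed (Set.range fun v => v + B v v) := by
    refine isClosed_range_of_lipschitz_inverse (by fun_prop) 0 fun R => ?_
    simpa only [dist_eq_norm, sub_zero] using exists_lipschitz_quadratic hB hlin hbdd R
  have hopen := (isOpenMap_quadratic hB hlin).isOpen_range
  exact Set.range_eq_univ.1 (IsClopen.eq_univ ⟨hclosed, hopen⟩ (Set.range_nonempty _))

end QuadraticMap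

section Calculus

open intervalIntegral Real

variable {a b : ℝ}

theorem sq_integral_mul_le {f g : ℝ → ℝ} (hf : Continuous f) (hg : Continuous g) (hab : a ≤ b) :
    (∫ x in a..b, f x * g x) ^ 2 ≤ (∫ x in a..b, f x ^ 2) * ∫ x in a..b, g x ^ 2 := by
  have hquad (t : ℝ) : 0 ≤ (∫ x in a..b, f x ^ 2) * (t * t) +
      (2 * ∫ x in a..b, f x * g x) * t + ∫ x in a..b, g x ^ 2 := by
    calc 0 ≤ ∫ x in a..b, (f x * t + g x) ^ 2 := integral_nonneg hab fun x _ => sq_nonneg _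
      _ = ∫ x in a..b, (f x ^ 2 * (t * t) + 2 * (f x * g x) * t + g x ^ 2) := by
        congr 1 with x; ring
      _ = _ := by
        rw [integral_add, integral_add, integral_mul_const, integral_mul_const, integral_const_mul]
        all_goals exact Continuous.intervalIntegrable (by fun_prop) _ _
  have := discrim_le_zero hquad
  rw [discrim] at this
  linarith

theorem sq_integral_abs_le {f : ℝ → ℝ} (hf : Continuous f) (hab : a ≤ b) :
    (∫ x in a..b, |f x|) ^ 2 ≤ (b - a) * ∫ x in a..b, f x ^ 2 := by
  simpa using sq_integral_mul_le (continuous_const (y := (1 : ℝ))) hf.abs hab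

theorem abs_sub_le_integral_abs_deriv {g g' : ℝ → ℝ} (hg : ∀ x, HasDerivAt g (g' x) x)
    (hg' : Continuous g') {x y : ℝ} (hx : x ∈ Set.Icc a b) (hy : y ∈ Set.Icc a b) :
    |g x - g y| ≤ ∫ t in a..b, |g' t| := by
  have hsub : Set.uIoc y x ⊆ Set.Ioc a b := by
    rw [Set.uIoc]
    exact Set.Ioc_subset_Ioc (le_min hy.1 hx.1) (max_le hy.2 hx.2)
  rw [← integral_eq_sub_of_hasDerivAt (fun t _ => hg t) (hg'.intervalIntegrable y x)]
  refine (norm_integral_le_integral_norm_uIoc (f := g')).trans ?_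
  rw [integral_of_le (hx.1.trans hx.2)]
  exact MeasureTheory.setIntegral_mono_set (hg'.abs.intervalIntegrable a b).1
    (MeasureTheory.ae_of_all _ fun t => norm_nonneg _) hsub.eventuallyLE

theorem abs_le_average_abs_add_integral_abs_deriv {g g' : ℝ → ℝ}
    (hg : ∀ x, HasDerivAt g (g' x) x) (hg' : Continuous g') (hab : a < b) {x : ℝ}
    (hx : x ∈ Set.Icc a b) :
    |g x| ≤ (b - a)⁻¹ * (∫ t in a..b, |g t|) + ∫ t in a..b, |g' t| := by
  have hgc : Continuous g := continuous_iff_continuousAt.2 fun t => (hg t).continuousAt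
  have hpoint : ∀ y ∈ Set.Icc a b, |g x| - (∫ t in a..b, |g' t|) ≤ |g y| := fun y hy => by
    have := abs_sub_le_integral_abs_deriv hg hg' hx hy
    have := abs_sub_abs_le_abs_sub (g x) (g y)
    linarith
  have hint : (b - a) * (|g x| - ∫ t in a..b, |g' t|) ≤ ∫ y in a..b, |g y| := by
    simpa only [integral_const, smul_eq_mul] using integral_mono_on (μ := MeasureTheory.volume)
      hab.le intervalIntegrable_const (hgc.abs.intervalIntegrable a b) hpoint
  rw [← sub_le_iff_le_add]
  exact (le_inv_mul_iff₀ (sub_pos.2 hab)).2 hint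

theorem exists_eq_zero_of_integral_eq_zero {e : ℝ → ℝ} (he : Continuous e) (hab : a < b)
    (hmean : ∫ x in a..b, e x = 0) : ∃ y ∈ Set.Icc a b, e y = 0 := by
  have hderiv (x : ℝ) : HasDerivAt (fun x => ∫ t in a..x, e t) (e x) x :=
    (he.integral_hasStrictDerivAt a x).hasDerivAt
  obtain ⟨y, hy, hey⟩ := exists_hasDerivAt_eq_zero hab
    (fun x _ => (hderiv x).continuousAt.continuousWithinAt) (by simp [hmean])
    (fun x _ => hderiv x)
  exact ⟨y, Set.Ioo_subset_Icc_self hy, hey⟩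

theorem sq_le_of_hasDerivAt {φ φ' : ℝ → ℝ} (hφ : ∀ x, HasDerivAt φ (φ' x) x)
    (hφ' : Continuous φ') (hab : a < b) {δ : ℝ} (hδ : 0 < δ) {x : ℝ} (hx : x ∈ Set.Icc a b) :
    φ x ^ 2 ≤ ((b - a)⁻¹ + δ⁻¹) * (∫ t in a..b, φ t ^ 2) + δ * ∫ t in a..b, φ' t ^ 2 := by
  have hφc : Continuous φ := continuous_iff_continuousAt.2 fun t => (hφ t).continuousAt
  have hyoung : ∫ t in a..b, |2 * φ t * φ' t| ≤
      δ⁻¹ * (∫ t in a..b, φ t ^ 2) + δ * ∫ t in a..b, φ' t ^ 2 := by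
    rw [← integral_const_mul, ← integral_const_mul, ← integral_add]
    · refine integral_mono_on hab.le ?_ ?_ fun t _ => ?_
      · exact Continuous.intervalIntegrable (by fun_prop) _ _
      · exact Continuous.intervalIntegrable (by fun_prop) _ _
      · have hsq : δ⁻¹ * φ t ^ 2 + δ * φ' t ^ 2 - |2 * φ t * φ' t| =
            δ⁻¹ * (|φ t| - δ * |φ' t|) ^ 2 := by
          rw [abs_mul, abs_mul, abs_two, ← sq_abs (φ t), ← sq_abs (φ' t)]
          field_simp
          ring
        have : 0 ≤ δ⁻¹ * (|φ t| - δ * |φ' t|) ^ 2 := by positivity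
        linarith
    all_goals exact Continuous.intervalIntegrable (by fun_prop) _ _
  have hsup := abs_le_average_abs_add_integral_abs_deriv
    (fun t => (hφ t).fun_pow 2) (by fun_prop) hab hx
  simp only [abs_sq, Nat.cast_ofNat, Nat.add_one_sub_one, pow_one] at hsup
  linarith

theorem two_mul_integral_mul_deriv_le {f φ φ' : ℝ → ℝ} (hf : Continuous f)
    (hφ : ∀ x, HasDerivAt φ (φ' x) x) (hφ' : Continuous φ') (hab : a < b) {Q : ℝ}
    (hQ : ∫ x in a..b, f x ^ 2 = Q) :
    2 * ∫ x in a..b, f x * φ x * φ' x ≤ (∫ x in a..b, φ' x ^ 2) +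
      2 * Q * ((b - a)⁻¹ + 4 * (Q + 1)) * ∫ x in a..b, φ x ^ 2 := by
  have hφc : Continuous φ := continuous_iff_continuousAt.2 fun t => (hφ t).continuousAt
  have hQ0 : 0 ≤ Q := hQ ▸ integral_nonneg hab.le fun x _ => sq_nonneg _
  have hφ'0 : 0 ≤ ∫ x in a..b, φ' x ^ 2 := integral_nonneg hab.le fun x _ => sq_nonneg _
  have hyoung : 2 * ∫ x in a..b, f x * φ x * φ' x ≤
      2⁻¹ * (∫ x in a..b, φ' x ^ 2) + 2 * ∫ x in a..b, f x ^ 2 * φ x ^ 2 := by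
    rw [← integral_const_mul, ← integral_const_mul, ← integral_const_mul, ← integral_add]
    · refine integral_mono_on hab.le ?_ ?_ fun t _ => ?_
      · exact Continuous.intervalIntegrable (by fun_prop) _ _
      · exact Continuous.intervalIntegrable (by fun_prop) _ _
      · linarith [sq_nonneg (φ' t - 2 * (f t * φ t))]
    all_goals exact Continuous.intervalIntegrable (by fun_prop) _ _
  have hsup : ∫ x in a..b, f x ^ 2 * φ x ^ 2 ≤ Q * (((b - a)⁻¹ + (4 * (Q + 1))⁻¹⁻¹) *
      (∫ x in a..b, φ x ^ 2) + (4 * (Q + 1))⁻¹ * ∫ x in a..b, φ' x ^ 2) := by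
    rw [← hQ, ← integral_mul_const, hQ]
    refine integral_mono_on hab.le ?_ ?_ fun t ht => ?_
    · exact Continuous.intervalIntegrable (by fun_prop) _ _
    · exact Continuous.intervalIntegrable (by fun_prop) _ _
    · exact mul_le_mul_of_nonneg_left (sq_le_of_hasDerivAt hφ hφ' hab (by positivity) ht)
        (sq_nonneg _)
  have habsorb : Q * (4 * (Q + 1))⁻¹ ≤ 4⁻¹ := by
    rw [← div_eq_mul_inv, div_le_iff₀ (by positivity)]
    linarith
  rw [inv_inv] at hsup
  linarith [mul_le_mul_of_nonneg_right habsorb hφ'0]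

theorem le_of_riccati {v w : ℝ → ℝ} {m Q : ℝ} (hv : Continuous v) (hab : a < b)
    (hw : ∀ x, HasDerivAt w (v x ^ 2 - m) x) (hwper : w b = w a)
    (hvmean : ∫ x in a..b, v x = 0) (hQ : ∫ x in a..b, (v x + w x) ^ 2 = Q) :
    m ≤ 2 * Q * ((b - a)⁻¹ + 4 * (Q + 1)) := by
  have hwc : Continuous w := continuous_iff_continuousAt.2 fun x => (hw x).continuousAt
  obtain ⟨φ, hφ, hφpos, hφper⟩ : ∃ φ : ℝ → ℝ, (∀ x, HasDerivAt φ (v x * φ x) x) ∧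
      (∀ x, 0 < φ x) ∧ φ b = φ a :=
    ⟨fun x => exp (∫ t in a..x, v t),
      fun x => mul_comm (v x) _ ▸ (hv.integral_hasStrictDerivAt a x).hasDerivAt.exp,
      fun x => exp_pos _, by simp [hvmean]⟩
  have hφc : Continuous φ := continuous_iff_continuousAt.2 fun x => (hφ x).continuousAt
  have hidentity : (∫ x in a..b, (v x * φ x) ^ 2) + m * ∫ x in a..b, φ x ^ 2 =
      2 * ∫ x in a..b, (v x + w x) * φ x * (v x * φ x) := by
    have hftc := integral_eq_sub_of_hasDerivAt (a := a) (b := b)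
      (fun x _ => (hw x).fun_mul ((hφ x).fun_pow 2))
      (Continuous.intervalIntegrable (by fun_prop) _ _)
    rw [hwper, hφper, sub_self] at hftc
    rw [eq_comm, ← sub_eq_zero, ← hftc, ← integral_const_mul, ← integral_const_mul,
      ← integral_add, ← integral_sub]
    · congr 1 with x
      push_cast
      ring
    all_goals exact Continuous.intervalIntegrable (by fun_prop) _ _
  have hφ2pos : 0 < ∫ x in a..b, φ x ^ 2 :=
    intervalIntegral_pos_of_pos (Continuous.intervalIntegrable (by fun_prop) _ _)
      (fun x => pow_pos (hφpos x) 2) hab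
  have hform := two_mul_integral_mul_deriv_le (hv.add hwc) hφ (by fun_prop) hab hQ
  refine le_of_mul_le_mul_right ?_ hφ2pos
  simp only [Pi.add_apply] at hform
  linarith

theorem exp_mul_abs_le_of_linear_ode {f F h e : ℝ → ℝ} {c : ℝ} (hF : ∀ x, HasDerivAt F (f x) x)
    (hFper : F b = F a) (hh : Continuous h) (hab : a < b)
    (he : ∀ x, HasDerivAt e (h x - f x * e x - c) x) (heper : e b = e a)
    (hemean : ∫ x in a..b, e x = 0) {x : ℝ} (hx : x ∈ Set.Icc a b) :
    exp (F x) * |e x| ≤ 2 * ∫ t in a..b, exp (F t) * |h t| := by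
  have hec : Continuous e := continuous_iff_continuousAt.2 fun x => (he x).continuousAt
  have hFc : Continuous F := continuous_iff_continuousAt.2 fun t => (hF t).continuousAt
  have hFe (t : ℝ) : HasDerivAt (fun t => exp (F t) * e t) (exp (F t) * h t - c * exp (F t)) t :=
    ((hF t).exp.fun_mul (he t)).congr_deriv (by ring)
  have hc : |c| * ∫ t in a..b, exp (F t) ≤ ∫ t in a..b, exp (F t) * |h t| := by
    have hftc := integral_eq_sub_of_hasDerivAt (a := a) (b := b) (fun t _ => hFe t)
      (Continuous.intervalIntegrable (by fun_prop) _ _)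
    rw [heper, hFper, sub_self, integral_sub, integral_const_mul, sub_eq_zero] at hftc
    · have hexp : 0 ≤ ∫ t in a..b, exp (F t) := integral_nonneg hab.le fun t _ => (exp_pos _).le
      rw [← abs_of_nonneg hexp, ← abs_mul, ← hftc]
      simpa only [abs_mul, abs_exp] using
        abs_integral_le_integral_abs (f := fun t => exp (F t) * h t) hab.le
    all_goals exact Continuous.intervalIntegrable (by fun_prop) _ _
  obtain ⟨y, hy, hey⟩ := exists_eq_zero_of_integral_eq_zero hec hab hemean
  calc exp (F x) * |e x|
      = |exp (F x) * e x - exp (F y) * e y| := by rw [hey, mul_zero, sub_zero, abs_mul, abs_exp]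
    _ ≤ ∫ t in a..b, |exp (F t) * h t - c * exp (F t)| :=
      abs_sub_le_integral_abs_deriv hFe (by fun_prop) hx hy
    _ ≤ ∫ t in a..b, (exp (F t) * |h t| + |c| * exp (F t)) := by
      refine integral_mono_on hab.le ?_ ?_ fun t _ => (abs_sub _ _).trans_eq ?_
      · exact Continuous.intervalIntegrable (by fun_prop) _ _
      · exact Continuous.intervalIntegrable (by fun_prop) _ _
      · rw [abs_mul, abs_mul, abs_exp]
    _ = (∫ t in a..b, exp (F t) * |h t|) + |c| * ∫ t in a..b, exp (F t) := by
      rw [integral_add, integral_const_mul]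
      all_goals exact Continuous.intervalIntegrable (by fun_prop) _ _
    _ ≤ _ := by linarith

theorem abs_le_of_linear_ode {f h e : ℝ → ℝ} {c : ℝ} (hf : Continuous f) (hh : Continuous h)
    (hab : a < b) (he : ∀ x, HasDerivAt e (h x - f x * e x - c) x) (heper : e b = e a)
    (hfmean : ∫ x in a..b, f x = 0) (hemean : ∫ x in a..b, e x = 0) {x : ℝ}
    (hx : x ∈ Set.Icc a b) :
    |e x| ≤ 2 * exp (∫ t in a..b, |f t|) * ∫ t in a..b, |h t| := by
  let F : ℝ → ℝ := fun x => ∫ t in a..x, f t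
  have hF (t : ℝ) : HasDerivAt F (f t) t := (hf.integral_hasStrictDerivAt a t).hasDerivAt
  have hFc : Continuous F := continuous_iff_continuousAt.2 fun t => (hF t).continuousAt
  have hFper : F b = F a := by simp [F, hfmean]
  have hweighted := exp_mul_abs_le_of_linear_ode hF hFper hh hab he heper hemean hx
  have hFosc : ∀ t ∈ Set.Icc a b, exp (F t) ≤ exp (F x) * exp (∫ t in a..b, |f t|) :=
    fun t ht => by
      rw [← exp_add]
      have := (abs_le.1 (abs_sub_le_integral_abs_deriv hF hf ht hx)).2
      exact exp_le_exp.2 (by linarith)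
  refine le_of_mul_le_mul_left (hweighted.trans ?_) (exp_pos (F x))
  calc 2 * ∫ t in a..b, exp (F t) * |h t|
      ≤ 2 * ∫ t in a..b, exp (F x) * exp (∫ t in a..b, |f t|) * |h t| := by
        gcongr
        refine integral_mono_on hab.le ?_ ?_ fun t ht => ?_
        · exact Continuous.intervalIntegrable (by fun_prop) _ _
        · exact Continuous.intervalIntegrable (by fun_prop) _ _
        · exact mul_le_mul_of_nonneg_right (hFosc t ht) (abs_nonneg _)
    _ = _ := by rw [integral_const_mul]; ring

theorem integral_sq_le_of_linear_ode {f d e : ℝ → ℝ} {c K : ℝ} (hf : Continuous f)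
    (hd : Continuous d) (hab : a < b) (he : ∀ x, HasDerivAt e (f x * d x - c) x)
    (heper : e b = e a) (hfmean : ∫ x in a..b, f x = 0) (hemean : ∫ x in a..b, e x = 0)
    (hK : ∫ x in a..b, f x ^ 2 = K) :
    ∫ x in a..b, d x ^ 2 ≤ (2 + 8 * ((b - a) * K) * exp (2 * √((b - a) * K))) *
      ∫ x in a..b, (d x + e x) ^ 2 := by
  have hec : Continuous e := continuous_iff_continuousAt.2 fun x => (he x).continuousAt
  set Q := ∫ x in a..b, (d x + e x) ^ 2 with hQ
  have hprod : (∫ x in a..b, |f x * (d x + e x)|) ^ 2 ≤ K * Q := by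
    simpa only [abs_mul, sq_abs, hK, Pi.add_apply] using
      sq_integral_mul_le hf.abs (hd.add hec).abs hab.le
  have hf1 : ∫ x in a..b, |f x| ≤ √((b - a) * K) :=
    le_sqrt_of_sq_le (hK ▸ sq_integral_abs_le hf hab.le)
  have hesq : ∀ x ∈ Set.Icc a b, e x ^ 2 ≤ 4 * exp (2 * √((b - a) * K)) * (K * Q) := by
    intro x hx
    have hsup := abs_le_of_linear_ode hf (hf.mul (hd.add hec)) hab
      (fun t => (he t).congr_deriv (by simp only [Pi.mul_apply, Pi.add_apply]; ring))
      heper hfmean hemean hx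
    calc e x ^ 2 = |e x| ^ 2 := (sq_abs _).symm
      _ ≤ (2 * exp √((b - a) * K) * ∫ t in a..b, |f t * (d t + e t)|) ^ 2 := by
        refine pow_le_pow_left₀ (abs_nonneg _) (hsup.trans ?_) 2
        have : 0 ≤ ∫ t in a..b, |f t * (d t + e t)| :=
          integral_nonneg hab.le fun t _ => abs_nonneg _
        simp only [Pi.mul_apply, Pi.add_apply]
        gcongr
      _ = 4 * exp (2 * √((b - a) * K)) * (∫ t in a..b, |f t * (d t + e t)|) ^ 2 := by
        rw [mul_pow, mul_pow, ← exp_nat_mul]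
        norm_num
      _ ≤ _ := by gcongr
  calc ∫ x in a..b, d x ^ 2
      ≤ ∫ x in a..b, (2 * (d x + e x) ^ 2 + 2 * (4 * exp (2 * √((b - a) * K)) * (K * Q))) := by
        refine integral_mono_on hab.le ?_ ?_ fun x hx => ?_
        · exact Continuous.intervalIntegrable (by fun_prop) _ _
        · exact Continuous.intervalIntegrable (by fun_prop) _ _
        · linarith [hesq x hx, sq_nonneg (d x + 2 * e x)]
    _ = _ := by
        rw [integral_add (Continuous.intervalIntegrable (by fun_prop) _ _)
          intervalIntegrable_const, integral_const_mul, integral_const, smul_eq_mul, ← hQ]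
        ring

end Calculus

section TrigonometricPolynomials

open Real

theorem TestFunction.hasDerivAt (φ : TestFunction) (x : ℝ) :
    HasDerivAt φ.1 ((TestFunction.deriv φ).1 x) x :=
  (φ.2.1.differentiable (by simp) x).hasDerivAt

theorem TestFunction.cos_zero_apply (x : ℝ) : (TestFunction.cos 0).1 x = 1 := by
  simp [TestFunction.cos]

theorem TestFunction.sin_zero : TestFunction.sin 0 = 0 := by
  ext x
  simp [TestFunction.sin]

theorem TestFunction.cos_neg (k : ℤ) : TestFunction.cos (-k) = TestFunction.cos k := by
  ext x
  simp [TestFunction.cos]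

theorem TestFunction.sin_neg (k : ℤ) : TestFunction.sin (-k) = -TestFunction.sin k := by
  ext x
  simp [TestFunction.sin]

theorem TestFunction.deriv_cos (k : ℤ) :
    TestFunction.deriv (TestFunction.cos k) = -(k : ℝ) • TestFunction.sin k := by
  ext x
  have hderiv : HasDerivAt (fun x : ℝ => Real.cos (k * x)) (-Real.sin (k * x) * k) x := by
    simpa using ((hasDerivAt_id x).const_mul (k : ℝ)).cos
  refine hderiv.deriv.trans ?_
  simp only [TestFunction.sin, Submodule.coe_smul, Pi.smul_apply, smul_eq_mul]
  ring

theorem TestFunction.deriv_sin (k : ℤ) :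
    TestFunction.deriv (TestFunction.sin k) = (k : ℝ) • TestFunction.cos k := by
  ext x
  have hderiv : HasDerivAt (fun x : ℝ => Real.sin (k * x)) (Real.cos (k * x) * k) x := by
    simpa using ((hasDerivAt_id x).const_mul (k : ℝ)).sin
  refine hderiv.deriv.trans ?_
  simp only [TestFunction.cos, Submodule.coe_smul, Pi.smul_apply, smul_eq_mul]
  ring

/-- The bound `‖φ‖_{C^N} ≤ B`, in which the continuity of distributions is expressed. -/
def TestFunction.BoundedBy (N : ℕ) (φ : TestFunction) (B : ℝ) : Prop :=
  ∀ j ≤ N, ∀ x, |iteratedDeriv j φ.1 x| ≤ B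

theorem TestFunction.boundedBy_zero {φ : TestFunction} {B : ℝ} :
    TestFunction.BoundedBy 0 φ B ↔ ∀ x, |φ.1 x| ≤ B := by
  simp [TestFunction.BoundedBy]

theorem TestFunction.boundedBy_succ {N : ℕ} {φ : TestFunction} {B : ℝ} :
    TestFunction.BoundedBy (N + 1) φ B ↔
      (∀ x, |φ.1 x| ≤ B) ∧ TestFunction.BoundedBy N (TestFunction.deriv φ) B := by
  refine ⟨fun h => ⟨fun x => by simpa using h 0 (Nat.zero_le _) x, fun j hj x => ?_⟩,
    fun h j hj x => ?_⟩
  · have := h (j + 1) (by lia) x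
    rwa [iteratedDeriv_succ'] at this
  · rcases j with _ | j
    · simpa using h.1 x
    · rw [iteratedDeriv_succ']
      exact h.2 j (by lia) x

theorem TestFunction.BoundedBy.abs_le {N : ℕ} {φ : TestFunction} {B : ℝ}
    (h : TestFunction.BoundedBy N φ B) (x : ℝ) : |φ.1 x| ≤ B := by
  simpa using h 0 (Nat.zero_le _) x

theorem TestFunction.BoundedBy.mono {N : ℕ} {φ : TestFunction} {B C : ℝ}
    (h : TestFunction.BoundedBy N φ B) (hBC : B ≤ C) : TestFunction.BoundedBy N φ C :=
  fun j hj x => (h j hj x).trans hBC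

theorem TestFunction.boundedBy_smul_cos_zero (N : ℕ) (c : ℝ) :
    TestFunction.BoundedBy N (c • TestFunction.cos 0) |c| := by
  intro j _ x
  have hconst : (c • TestFunction.cos 0).1 = fun _ => c := by
    ext x
    simp [TestFunction.cos_zero_apply]
  rw [hconst, iteratedDeriv_const]
  split_ifs <;> simp

theorem TestFunction.BoundedBy.add {N : ℕ} {φ ψ : TestFunction} {B C : ℝ}
    (hφ : TestFunction.BoundedBy N φ B) (hψ : TestFunction.BoundedBy N ψ C) :
    TestFunction.BoundedBy N (φ + ψ) (B + C) := by
  intro j hj x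
  have hsmooth (χ : TestFunction) : ContDiffAt ℝ j χ.1 x :=
    (χ.2.1.of_le (by exact_mod_cast le_top)).contDiffAt
  change |iteratedDeriv j (φ.1 + ψ.1) x| ≤ B + C
  rw [iteratedDeriv_add (hsmooth φ) (hsmooth ψ)]
  exact (abs_add_le _ _).trans (add_le_add (hφ j hj x) (hψ j hj x))

theorem TestFunction.exists_deriv_eq_zero (φ : TestFunction) :
    ∃ y, (TestFunction.deriv φ).1 y = 0 := by
  obtain ⟨y, -, hy⟩ := exists_hasDerivAt_eq_zero two_pi_pos φ.2.1.continuous.continuousOn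
    (by simpa using (φ.2.2 0).symm) (fun x _ => TestFunction.hasDerivAt φ x)
  exact ⟨y, hy⟩

theorem TestFunction.abs_le_of_abs_deriv_le {φ : TestFunction} {δ : ℝ} (hφ0 : φ.1 0 = 0)
    (hδ : ∀ x, |(TestFunction.deriv φ).1 x| ≤ δ) (x : ℝ) : |φ.1 x| ≤ δ * (2 * π) := by
  obtain ⟨y, hy, hxy⟩ := φ.2.2.exists_mem_Ico₀ two_pi_pos x
  have hmvt : |φ.1 y - φ.1 0| ≤ δ * |y - 0| :=
    Convex.norm_image_sub_le_of_norm_hasDerivWithin_le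
      (fun t _ => (TestFunction.hasDerivAt φ t).hasDerivWithinAt) (fun t _ => hδ t)
      convex_univ (Set.mem_univ _) (Set.mem_univ _)
  rw [hφ0, sub_zero, sub_zero, abs_of_nonneg hy.1] at hmvt
  rw [hxy]
  exact hmvt.trans (mul_le_mul_of_nonneg_left hy.2.le ((abs_nonneg _).trans (hδ 0)))

/-- Real trigonometric polynomials. -/
def trigPoly : Submodule ℝ TestFunction :=
  Submodule.span ℝ (Set.range TestFunction.cos ∪ Set.range TestFunction.sin)

theorem cos_mem_trigPoly (k : ℤ) : TestFunction.cos k ∈ trigPoly :=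
  Submodule.subset_span (Or.inl ⟨k, rfl⟩)

theorem sin_mem_trigPoly (k : ℤ) : TestFunction.sin k ∈ trigPoly :=
  Submodule.subset_span (Or.inr ⟨k, rfl⟩)

theorem exists_deriv_add_const_of_mem_trigPoly {p : TestFunction} (hp : p ∈ trigPoly) :
    ∃ q ∈ trigPoly, ∃ c : ℝ, p = TestFunction.deriv q + c • TestFunction.cos 0 := by
  induction hp using Submodule.span_induction with
  | mem p hp =>
    rcases hp with ⟨k, rfl⟩ | ⟨k, rfl⟩ <;> rcases eq_or_ne k 0 with rfl | hk
    · exact ⟨0, zero_mem _, 1, by simp⟩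
    · exact ⟨(k : ℝ)⁻¹ • TestFunction.sin k, trigPoly.smul_mem _ (sin_mem_trigPoly k), 0, by
        simp [TestFunction.deriv_sin, smul_smul, hk]⟩
    · exact ⟨0, zero_mem _, 0, by simp [TestFunction.sin_zero]⟩
    · exact ⟨-(k : ℝ)⁻¹ • TestFunction.cos k, trigPoly.smul_mem _ (cos_mem_trigPoly k), 0, by
        simp [TestFunction.deriv_cos, smul_smul, hk]⟩
  | zero => exact ⟨0, zero_mem _, 0, by simp⟩
  | add p p' _ _ ih ih' =>
    obtain ⟨q, hq, c, rfl⟩ := ih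
    obtain ⟨q', hq', c', rfl⟩ := ih'
    exact ⟨q + q', add_mem hq hq', c + c', by rw [map_add, add_smul]; abel⟩
  | smul r p _ ih =>
    obtain ⟨q, hq, c, rfl⟩ := ih
    exact ⟨r • q, trigPoly.smul_mem _ hq, r * c, by rw [map_smul, smul_add, smul_smul]⟩

theorem fourier_apply_of_eq_two_pi {T : ℝ} (hT : T = 2 * π) (n : ℤ) (x : ℝ) :
    fourier n (x : AddCircle T) = Complex.exp ((n * x : ℝ) * Complex.I) := by
  rw [fourier_coe_apply, hT]
  congr 1
  have : (π : ℂ) ≠ 0 := by exact_mod_cast pi_ne_zero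
  push_cast
  field_simp

theorem exists_re_im_mem_trigPoly {q : C(AddCircle (2 * π), ℂ)}
    (hq : q ∈ Submodule.span ℂ (Set.range (@fourier (2 * π)))) :
    (∃ p ∈ trigPoly, ∀ x : ℝ, p.1 x = (q x).re) ∧
      ∃ p ∈ trigPoly, ∀ x : ℝ, p.1 x = (q x).im := by
  induction hq using Submodule.span_induction with
  | mem p hp =>
    obtain ⟨n, rfl⟩ := hp
    refine ⟨⟨_, cos_mem_trigPoly n, fun x => ?_⟩, ⟨_, sin_mem_trigPoly n, fun x => ?_⟩⟩
    · rw [fourier_apply_of_eq_two_pi rfl, Complex.exp_ofReal_mul_I_re]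
      rfl
    · rw [fourier_apply_of_eq_two_pi rfl, Complex.exp_ofReal_mul_I_im]
      rfl
  | zero => exact ⟨⟨0, zero_mem _, by simp⟩, ⟨0, zero_mem _, by simp⟩⟩
  | add p p' _ _ ih ih' =>
    obtain ⟨⟨r, hr, hrx⟩, ⟨i, hi, hix⟩⟩ := ih
    obtain ⟨⟨r', hr', hrx'⟩, ⟨i', hi', hix'⟩⟩ := ih'
    exact ⟨⟨r + r', add_mem hr hr', fun x => by simp [hrx, hrx']⟩,
      ⟨i + i', add_mem hi hi', fun x => by simp [hix, hix']⟩⟩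
  | smul c p _ ih =>
    obtain ⟨⟨r, hr, hrx⟩, ⟨i, hi, hix⟩⟩ := ih
    exact ⟨⟨c.re • r - c.im • i, sub_mem (trigPoly.smul_mem _ hr) (trigPoly.smul_mem _ hi),
      fun x => by simp [hrx, hix]⟩, ⟨c.re • i + c.im • r,
      add_mem (trigPoly.smul_mem _ hi) (trigPoly.smul_mem _ hr), fun x => by simp [hrx, hix]⟩⟩

theorem exists_trigPoly_abs_sub_le (φ : TestFunction) {ε : ℝ} (hε : 0 < ε) :
    ∃ p ∈ trigPoly, ∀ x, |(φ - p).1 x| ≤ ε := by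
  have : Fact (0 < 2 * π) := ⟨two_pi_pos⟩
  have hper : Function.Periodic (fun x => (φ.1 x : ℂ)) (2 * π) := fun x => by
    simp only [φ.2.2 x]
  let Φ : C(AddCircle (2 * π), ℂ) := ⟨hper.lift, continuous_coinduced_dom.mpr
    (Complex.continuous_ofReal.comp φ.2.1.continuous)⟩
  have hΦ : Φ ∈ (Submodule.span ℂ (Set.range (@fourier (2 * π)))).topologicalClosure := by
    rw [span_fourier_closure_eq_top]
    trivial
  obtain ⟨q, hq, hqΦ⟩ := Metric.mem_closure_iff.1 hΦ ε hε
  obtain ⟨⟨p, hp, hpx⟩, -⟩ := exists_re_im_mem_trigPoly hq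
  refine ⟨p, hp, fun x => ?_⟩
  calc |(φ - p).1 x| = |((Φ - q) (x : AddCircle (2 * π))).re| := by
        rw [Submodule.coe_sub, Pi.sub_apply, hpx]
        rfl
    _ ≤ ‖Φ - q‖ := (Complex.abs_re_le_norm _).trans (ContinuousMap.norm_coe_le_norm _ _)
    _ ≤ ε := (dist_eq_norm Φ q ▸ hqΦ).le

theorem exists_trigPoly_boundedBy_sub (N : ℕ) (φ : TestFunction) {ε : ℝ} (hε : 0 < ε) :
    ∃ p ∈ trigPoly, TestFunction.BoundedBy N (φ - p) ε := by
  induction N generalizing φ ε with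
  | zero => simpa only [TestFunction.boundedBy_zero] using exists_trigPoly_abs_sub_le φ hε
  | succ N ih =>
    obtain ⟨δ, hδ, hδε⟩ : ∃ δ > 0, (δ + δ) * (2 * π) = ε :=
      ⟨ε / (4 * π), by positivity, by field_simp; ring⟩
    obtain ⟨p, hp, hφp⟩ := ih (TestFunction.deriv φ) hδ
    obtain ⟨q, hq, c, rfl⟩ := exists_deriv_add_const_of_mem_trigPoly hp
    -- The constant `c` is small because the derivative of a periodic function has a zero.
    have hc : |c| ≤ δ := by
      obtain ⟨y, hy⟩ := TestFunction.exists_deriv_eq_zero (φ - q)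
      have hval : (TestFunction.deriv φ - (TestFunction.deriv q + c • TestFunction.cos 0)).1 y
          = (TestFunction.deriv (φ - q)).1 y - c := by
        simp only [map_sub, Submodule.coe_sub, Submodule.coe_add, Submodule.coe_smul, Pi.sub_apply,
          Pi.add_apply, Pi.smul_apply, smul_eq_mul, TestFunction.cos_zero_apply]
        ring
      have := hφp.abs_le y
      rwa [hval, hy, zero_sub, abs_neg] at this
    let r : TestFunction := q + (φ - q).1 0 • TestFunction.cos 0
    have hderiv : TestFunction.deriv (φ - r) = TestFunction.deriv φ -
        (TestFunction.deriv q + c • TestFunction.cos 0) + c • TestFunction.cos 0 := by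
      simp only [r, map_sub, map_add, map_smul, TestFunction.deriv_cos, Int.cast_zero, neg_zero,
        zero_smul, smul_zero]
      abel
    have hbound : TestFunction.BoundedBy N (TestFunction.deriv (φ - r)) (δ + δ) :=
      hderiv ▸ hφp.add (TestFunction.BoundedBy.mono (TestFunction.boundedBy_smul_cos_zero N c) hc)
    have hzero : (φ - r).1 0 = 0 := by
      simp [r, TestFunction.cos_zero_apply]
    refine ⟨r, add_mem hq (trigPoly.smul_mem _ (cos_mem_trigPoly 0)),
      TestFunction.boundedBy_succ.2 ⟨fun x => ?_, hbound.mono ?_⟩⟩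
    · exact hδε ▸ TestFunction.abs_le_of_abs_deriv_le hzero hbound.abs_le x
    · rw [← hδε]
      exact le_mul_of_one_le_right (by positivity) (by linarith [pi_gt_three])

end TrigonometricPolynomials

section DistributionCoefficients

open Real

theorem Distribution.eq_zero_of_trigPoly {u : Distribution} (h : ∀ p ∈ trigPoly, u.1 p = 0) :
    u = 0 := by
  ext φ
  obtain ⟨N, C, hC⟩ := u.2
  have hle : ∀ ε > 0, |u.1 φ| ≤ C * ε := fun ε hε => by
    obtain ⟨p, hp, hφp⟩ := exists_trigPoly_boundedBy_sub N φ hε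
    have := hC (φ - p) ε hφp
    rwa [map_sub, h p hp, sub_zero] at this
  have hlim : Filter.Tendsto (fun ε : ℝ => C * ε) (nhdsWithin 0 (Set.Ioi 0)) (nhds 0) :=
    tendsto_nhdsWithin_of_tendsto_nhds (Continuous.tendsto' (by fun_prop) _ _ (mul_zero C))
  exact abs_nonpos_iff.1 (ge_of_tendsto hlim (Filter.eventually_of_mem self_mem_nhdsWithin hle))

theorem fourierCoeff_re (u : Distribution) (k : ℤ) :
    (fourierCoeff u k).re = (2 * π)⁻¹ * u.1 (TestFunction.cos k) := by
  simp [fourierCoeff]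

theorem fourierCoeff_im (u : Distribution) (k : ℤ) :
    (fourierCoeff u k).im = -((2 * π)⁻¹ * u.1 (TestFunction.sin k)) := by
  simp [fourierCoeff]

theorem fourierCoeff_add (u v : Distribution) :
    fourierCoeff (u + v) = fourierCoeff u + fourierCoeff v := by
  ext k
  simp only [fourierCoeff, Pi.add_apply, Submodule.coe_add, LinearMap.add_apply, Complex.ofReal_add]
  ring

theorem fourierCoeff_sub (u v : Distribution) :
    fourierCoeff (u - v) = fourierCoeff u - fourierCoeff v := by
  ext k
  simp only [fourierCoeff, Pi.sub_apply, Submodule.coe_sub, LinearMap.sub_apply, Complex.ofReal_sub]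
  ring

theorem fourierCoeff_zero (k : ℤ) : fourierCoeff 0 k = 0 := by simp [fourierCoeff]

theorem fourierCoeff_neg (u : Distribution) (k : ℤ) :
    fourierCoeff u (-k) = starRingEnd ℂ (fourierCoeff u k) := by
  simp [fourierCoeff, TestFunction.cos_neg, TestFunction.sin_neg, map_ofNat]

theorem fourierCoeff_dx (u : Distribution) (k : ℤ) :
    fourierCoeff (dx u) k = Complex.I * k * fourierCoeff u k := by
  have hcos : (dx u).1 (TestFunction.cos k) = k * u.1 (TestFunction.sin k) := by
    simp [dx, TestFunction.deriv_cos]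
  have hsin : (dx u).1 (TestFunction.sin k) = -(k * u.1 (TestFunction.cos k)) := by
    simp [dx, TestFunction.deriv_sin]
  rw [fourierCoeff, fourierCoeff, hcos, hsin]
  push_cast
  linear_combination (1 / (2 * π : ℂ) * k * u.1 (TestFunction.sin k)) * Complex.I_sq

theorem Distribution.ext_fourierCoeff {u v : Distribution} (h : fourierCoeff u = fourierCoeff v) :
    u = v := by
  have hcoeff (k : ℤ) : fourierCoeff (u - v) k = 0 := by
    rw [fourierCoeff_sub, h, sub_self, Pi.zero_apply]
  refine sub_eq_zero.1 (Distribution.eq_zero_of_trigPoly fun p hp => ?_)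
  induction hp using Submodule.span_induction with
  | mem p hp =>
    rcases hp with ⟨k, rfl⟩ | ⟨k, rfl⟩
    · simpa [hcoeff] using (fourierCoeff_re (u - v) k).symm
    · simpa [hcoeff] using (fourierCoeff_im (u - v) k).symm
  | zero => exact map_zero _
  | add p q _ _ hp hq => rw [map_add, hp, hq, add_zero]
  | smul c p _ hp => rw [map_smul, hp, smul_zero]

end DistributionCoefficients

section CircleFourierSeries

open MeasureTheory AddCircle ComplexConjugate

variable {T : ℝ} [Fact (0 < T)]

theorem fourierCoeff_conj (f : AddCircle T → ℂ) (k : ℤ) :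
    _root_.fourierCoeff (fun x => conj (f x)) k = conj (_root_.fourierCoeff f (-k)) := by
  simp only [_root_.fourierCoeff, ← integral_conj, smul_eq_mul, map_mul, fourier_neg, neg_neg]

theorem hasSum_fourierCoeff_mul {f g : AddCircle T → ℂ} (hf : MemLp f 2 haarAddCircle)
    (hg : MemLp g 2 haarAddCircle) (k : ℤ) :
    HasSum (fun j => _root_.fourierCoeff f (k - j) * _root_.fourierCoeff g j)
      (_root_.fourierCoeff (fun x => f x * g x) k) := by
  let F : AddCircle T → ℂ := fun x => conj (f x) * fourier k x
  have hF : MemLp F 2 haarAddCircle := by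
    refine hf.of_le ((continuous_star.comp_aestronglyMeasurable hf.1).mul
      (fourier k).continuous.aestronglyMeasurable) (ae_of_all _ fun x => ?_)
    simp only [F, fourier_apply, norm_mul, RCLike.norm_conj, Circle.norm_coe, mul_one, le_refl]
  have hFcoeff (j : ℤ) :
      conj (_root_.fourierCoeff F j) = _root_.fourierCoeff f (k - j) := by
    simp only [_root_.fourierCoeff, F, ← integral_conj, smul_eq_mul, map_mul, fourier_neg,
      Complex.conj_conj, sub_eq_add_neg, neg_add, fourier_add]
    exact integral_congr_ae (ae_of_all _ fun x => by ring)
  have hterm (j : ℤ) : inner ℂ hF.toLp (fourierBasis j) * inner ℂ (fourierBasis j) hg.toLp =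
      _root_.fourierCoeff f (k - j) * _root_.fourierCoeff g j := by
    rw [← inner_conj_symm, ← fourierBasis.repr_apply_apply, ← fourierBasis.repr_apply_apply,
      fourierBasis_repr, fourierBasis_repr, fourierCoeff_congr_ae hF.coeFn_toLp,
      fourierCoeff_congr_ae hg.coeFn_toLp, hFcoeff]
  have hinner : inner ℂ hF.toLp hg.toLp = _root_.fourierCoeff (fun x => f x * g x) k := by
    rw [L2.inner_def, _root_.fourierCoeff]
    refine integral_congr_ae ?_
    filter_upwards [hF.coeFn_toLp, hg.coeFn_toLp] with x hFx hgx
    simp only [hFx, hgx, F, RCLike.inner_apply', map_mul, Complex.conj_conj, fourier_neg,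
      smul_eq_mul]
    ring
  have hparseval := fourierBasis.hasSum_inner_mul_inner hF.toLp hg.toLp
  rw [hinner] at hparseval
  exact hparseval.congr_fun fun j => (hterm j).symm

theorem exists_memLp_re_fourierCoeff_eq (a : lp (fun _ : ℤ => ℂ) 2)
    (ha : ∀ k, a (-k) = conj (a k)) :
    ∃ g : AddCircle T → ℝ, MemLp g 2 ∧
      _root_.fourierCoeff (fun x => (g x : ℂ)) = a := by
  let G := (fourierBasis (T := T)).repr.symm a
  have hG : MemLp G 2 haarAddCircle := Lp.memLp G
  have hcoeff (k : ℤ) : _root_.fourierCoeff G k = a k := by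
    rw [← fourierBasis_repr, LinearIsometryEquiv.apply_symm_apply]
  have hre : (fun x => ((G x).re : ℂ)) = fun x => 2⁻¹ * (G x + conj (G x)) := by
    ext x
    rw [Complex.re_eq_add_conj]
    ring
  refine ⟨fun x => (G x).re, hG.of_haarAddCircle.re, funext fun k => ?_⟩
  have hadd := fourierCoeff.add (hG.integrable one_le_two) (hG.star.integrable one_le_two)
  calc _root_.fourierCoeff (fun x => ((G x).re : ℂ)) k
      = 2⁻¹ * (_root_.fourierCoeff G k + _root_.fourierCoeff (fun x => conj (G x)) k) := by
        rw [hre, fourierCoeff.const_mul]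
        exact congrArg (2⁻¹ * ·) (congrFun hadd k)
    _ = a k := by
        rw [fourierCoeff_conj, hcoeff, hcoeff, ha, Complex.conj_conj]
        ring

end CircleFourierSeries

section RealFourierCoefficients

open MeasureTheory Real ComplexConjugate

/-- Fourier coefficients of a real function on the period `(0, 2π]`. -/
noncomputable def realCoeff (f : ℝ → ℝ) (k : ℤ) : ℂ :=
  fourierCoeffOn two_pi_pos (fun x => (f x : ℂ)) k

/-- Lebesgue measure on the period `(0, 2π]`. -/
noncomputable abbrev periodMeasure : Measure ℝ := volume.restrict (Set.Ioc 0 (2 * π))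

theorem realCoeff_eq_integral (f : ℝ → ℝ) (k : ℤ) :
    realCoeff f k = (2 * π : ℂ)⁻¹ * ∫ x in Set.Ioc 0 (2 * π),
      f x * (Complex.cos (k * x) - Complex.I * Complex.sin (k * x)) := by
  have hfourier (x : ℝ) : fourier (-k) (x : AddCircle (2 * π - 0)) =
      Complex.cos (k * x) - Complex.I * Complex.sin (k * x) := by
    rw [fourier_apply_of_eq_two_pi (sub_zero _), Complex.exp_mul_I]
    push_cast
    rw [neg_mul, Complex.cos_neg, Complex.sin_neg]
    ring
  rw [realCoeff, fourierCoeffOn_eq_integral, intervalIntegral.integral_of_le two_pi_pos.le,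
    Complex.real_smul]
  simp only [hfourier, smul_eq_mul, mul_comm]
  simp

theorem realCoeff_zero (f : ℝ → ℝ) :
    realCoeff f 0 = ((2 * π)⁻¹ * ∫ x in (0 : ℝ)..2 * π, f x : ℝ) := by
  rw [realCoeff_eq_integral, intervalIntegral.integral_of_le two_pi_pos.le]
  push_cast
  rw [← integral_complex_ofReal]
  simp

theorem integrable_ofReal_mul {f : ℝ → ℝ} (hf : Integrable f periodMeasure) {g : ℝ → ℂ}
    (hg : Continuous g) : Integrable (fun x => (f x : ℂ) * g x) periodMeasure :=
  IntegrableOn.mul_continuousOn_of_subset hf.ofReal hg.continuousOn measurableSet_Ioc isCompact_Icc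
    Set.Ioc_subset_Icc_self

theorem realCoeff_add {f g : ℝ → ℝ} (hf : Integrable f periodMeasure)
    (hg : Integrable g periodMeasure) (k : ℤ) :
    realCoeff (fun x => f x + g x) k = realCoeff f k + realCoeff g k := by
  simp only [realCoeff_eq_integral, ← mul_add]
  rw [← integral_add (integrable_ofReal_mul hf (by fun_prop))
    (integrable_ofReal_mul hg (by fun_prop))]
  simp only [Complex.ofReal_add, add_mul]

theorem realCoeff_sub {f g : ℝ → ℝ} (hf : Integrable f periodMeasure)
    (hg : Integrable g periodMeasure) (k : ℤ) :
    realCoeff (fun x => f x - g x) k = realCoeff f k - realCoeff g k := by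
  refine eq_sub_of_add_eq ((realCoeff_add (hf.sub hg) hg k).symm.trans ?_)
  simp only [Pi.sub_apply, sub_add_cancel]

theorem realCoeff_of_hasDerivAt {e e' : ℝ → ℝ} (he : ∀ x, HasDerivAt e (e' x) x)
    (he' : Continuous e') (hper : e (2 * π) = e 0) (k : ℤ) :
    realCoeff e' k = Complex.I * k * realCoeff e k := by
  rcases eq_or_ne k 0 with rfl | hk
  · rw [realCoeff_zero, intervalIntegral.integral_eq_sub_of_hasDerivAt (fun x _ => he x)
      (he'.intervalIntegrable _ _), hper]
    simp
  · have hparts := fourierCoeffOn_of_hasDerivAt two_pi_pos hk (fun x _ => (he x).ofReal_comp)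
      ((Complex.continuous_ofReal.comp he').intervalIntegrable 0 (2 * π))
    rw [hper, sub_self, mul_zero, zero_sub] at hparts
    change realCoeff e k = _ at hparts
    have hπ : (π : ℂ) ≠ 0 := by exact_mod_cast pi_ne_zero
    have hk' : (k : ℂ) ≠ 0 := by exact_mod_cast hk
    rw [hparts, realCoeff]
    push_cast
    rw [sub_zero]
    field_simp

theorem realCoeff_const (c : ℝ) (k : ℤ) :
    realCoeff (fun _ => c) k = if k = 0 then (c : ℂ) else 0 := by
  split_ifs with hk
  · rw [hk, realCoeff_zero, intervalIntegral.integral_const, smul_eq_mul, sub_zero,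
      inv_mul_cancel_left₀ two_pi_pos.ne']
  · have h := realCoeff_of_hasDerivAt (e := fun _ => c) (fun x => hasDerivAt_const x c)
      continuous_const rfl k
    have hIk : Complex.I * k ≠ 0 := by simp [hk]
    rw [realCoeff_eq_integral] at h
    simpa [hIk] using h.symm

theorem realCoeff_neg (f : ℝ → ℝ) (k : ℤ) : realCoeff f (-k) = conj (realCoeff f k) := by
  simp only [realCoeff_eq_integral, map_mul, ← integral_conj, map_sub, Complex.conj_ofReal,
    Complex.conj_I, ← Complex.cos_conj, ← Complex.sin_conj, map_inv₀, map_ofNat, map_intCast]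
  push_cast
  simp only [neg_mul, Complex.cos_neg, Complex.sin_neg, mul_neg]

theorem memLp_liftIoc_ofReal {f : ℝ → ℝ} (hf : MemLp f 2 periodMeasure)
    [Fact (0 < 2 * π - 0)] :
    MemLp (AddCircle.liftIoc (2 * π - 0) 0 fun x => (f x : ℂ)) 2 AddCircle.haarAddCircle := by
  refine (MemLp.memLp_liftIoc ?_).haarAddCircle
  rw [add_sub_cancel]
  exact hf.ofReal

theorem hasSum_realCoeff_mul {f g : ℝ → ℝ} (hf : MemLp f 2 periodMeasure)
    (hg : MemLp g 2 periodMeasure) (k : ℤ) :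
    HasSum (fun j => realCoeff f (k - j) * realCoeff g j) (realCoeff (fun x => f x * g x) k) := by
  have : Fact (0 < 2 * π - 0) := ⟨by simpa using pi_pos⟩
  have h := hasSum_fourierCoeff_mul (memLp_liftIoc_ofReal hf) (memLp_liftIoc_ofReal hg) k
  simp only [realCoeff, Complex.ofReal_mul]
  exact h

theorem hasSum_sq_norm_realCoeff {f : ℝ → ℝ} (hf : MemLp f 2 periodMeasure) :
    HasSum (fun k => ‖realCoeff f k‖ ^ 2) ((2 * π)⁻¹ * ∫ x in (0 : ℝ)..2 * π, f x ^ 2) := by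
  simpa [realCoeff] using hasSum_sq_fourierCoeffOn two_pi_pos (hf.ofReal (K := ℂ))

theorem exists_memLp_realCoeff_eq (a : lp (fun _ : ℤ => ℂ) 2) (ha : ∀ k, a (-k) = conj (a k)) :
    ∃ f : ℝ → ℝ, MemLp f 2 periodMeasure ∧ realCoeff f = a := by
  have : Fact (0 < 2 * π - 0) := ⟨by simpa using pi_pos⟩
  obtain ⟨g, hg, hga⟩ := exists_memLp_re_fourierCoeff_eq (T := 2 * π - 0) a ha
  refine ⟨fun x => g x, ?_, ?_⟩
  · have hperiod : periodMeasure = volume.restrict (Set.Ioc 0 (0 + (2 * π - 0))) := by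
      rw [add_sub_cancel]
    rw [hperiod]
    exact hg.comp_measurePreserving (AddCircle.measurePreserving_mk (2 * π - 0) 0)
  · rw [← hga]
    ext k
    refine congrArg (_root_.fourierCoeff · k) (funext fun x => ?_)
    exact congrArg (fun y => (g y : ℂ)) (AddCircle.coe_equivIoc)

end RealFourierCoefficients

section DistributionsFromFunctions

open MeasureTheory Real

theorem fourierCoeff_eq_realCoeff {u : Distribution} {f : ℝ → ℝ}
    (hf : Integrable f periodMeasure)
    (hu : ∀ φ : TestFunction, u.1 φ = ∫ x in Set.Ioc 0 (2 * π), f x * φ.1 x) :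
    fourierCoeff u = realCoeff f := by
  ext k
  have hint (φ : TestFunction) : Integrable (fun x => ((f x * φ.1 x : ℝ) : ℂ)) periodMeasure := by
    simpa using integrable_ofReal_mul hf (Complex.continuous_ofReal.comp φ.2.1.continuous)
  rw [fourierCoeff, realCoeff_eq_integral, hu, hu, ← integral_complex_ofReal,
    ← integral_complex_ofReal, ← integral_const_mul,
    ← integral_sub (hint _) ((hint _).const_mul _)]
  simp only [TestFunction.cos, TestFunction.sin, one_div]
  congr 2
  ext x
  push_cast
  ring

theorem fourierCoeff_ofFun {f : ℝ → ℝ} (hf : IntegrableOn f (Set.Ioc 0 (2 * π))) :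
    fourierCoeff (ofFun f hf) = realCoeff f :=
  fourierCoeff_eq_realCoeff hf fun _ => rfl

theorem fourierCoeff_P0 (u : Distribution) (k : ℤ) :
    fourierCoeff (P0 u) k = if k = 0 then fourierCoeff u 0 else 0 := by
  rw [P0, fourierCoeff_ofFun, realCoeff_const]
  simp [fourierCoeff, TestFunction.sin_zero]

theorem P0_eq_zero_iff (u : Distribution) : P0 u = 0 ↔ fourierCoeff u 0 = 0 := by
  refine ⟨fun h => ?_, fun h => Distribution.ext_fourierCoeff (funext fun k => ?_)⟩
  · have hmean := fourierCoeff_P0 u 0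
    rw [h, fourierCoeff_zero, if_pos rfl] at hmean
    exact hmean.symm
  · rw [fourierCoeff_P0, h, ite_self, fourierCoeff_zero]

end DistributionsFromFunctions

section SquareSummableSequences

open MeasureTheory
open scoped ENNReal

variable {ι E F : Type*} [MeasurableSpace ι] [MeasurableSingletonClass ι] [NormedAddCommGroup E]
  [NormedAddCommGroup F]

theorem eLpNorm_two_count (a : ι → E) :
    eLpNorm a 2 .count = (∑' i, ‖a i‖ₑ ^ (2 : ℝ)) ^ (1 / 2 : ℝ) := by
  rw [eLpNorm_eq_lintegral_rpow_enorm_toReal two_ne_zero ENNReal.ofNat_ne_top, lintegral_count,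
    ENNReal.toReal_ofNat]

theorem enorm_rpow_two (x : E) : ‖x‖ₑ ^ (2 : ℝ) = ENNReal.ofReal (‖x‖ ^ 2) := by
  rw [← ofReal_norm, ENNReal.ofReal_rpow_of_nonneg (norm_nonneg x) zero_le_two, Real.rpow_two]

theorem eLpNorm_two_count_ne_top_iff {a : ι → E} :
    eLpNorm a 2 .count ≠ ∞ ↔ Summable fun i => ‖a i‖ ^ 2 := by
  rw [eLpNorm_two_count, Ne, ENNReal.rpow_eq_top_iff_of_pos one_half_pos]
  simp only [enorm_rpow_two]
  refine ⟨fun h => (ENNReal.summable_toReal h).congr fun i => ?_, fun h => h.tsum_ofReal_ne_top⟩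
  exact ENNReal.toReal_ofReal (sq_nonneg _)

theorem toReal_eLpNorm_two_count (a : ι → E) :
    (eLpNorm a 2 .count).toReal = √(∑' i, ‖a i‖ ^ 2) := by
  rw [eLpNorm_two_count, ← ENNReal.toReal_rpow, ENNReal.tsum_toReal_eq, Real.sqrt_eq_rpow]
  · simp only [enorm_rpow_two, ENNReal.toReal_ofReal (sq_nonneg _)]
  · simp only [enorm_rpow_two, ne_eq, ENNReal.ofReal_ne_top, not_false_eq_true, implies_true]

theorem eLpNorm_two_count_comp_equiv (e : ι ≃ ι) (a : ι → E) :
    eLpNorm (fun i => a (e i)) 2 .count = eLpNorm a 2 .count := by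
  rw [eLpNorm_two_count, eLpNorm_two_count, e.tsum_eq fun i => ‖a i‖ₑ ^ (2 : ℝ)]

theorem tsum_enorm_mul_enorm_le [Countable ι] (a : ι → E) (b : ι → F) :
    ∑' i, ‖a i‖ₑ * ‖b i‖ₑ ≤ eLpNorm a 2 .count * eLpNorm b 2 .count := by
  have h := ENNReal.lintegral_mul_le_Lp_mul_Lq .count (f := fun i => ‖a i‖ₑ)
    (g := fun i => ‖b i‖ₑ) Real.HolderConjugate.two_two
    (measurable_of_countable _).aemeasurable (measurable_of_countable _).aemeasurable
  simpa only [lintegral_count, Pi.mul_apply, eLpNorm_two_count] using h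

end SquareSummableSequences

section JapaneseBracket

/-- The Japanese bracket `⟨k⟩ = (1 + k²)^{1/2}`. -/
noncomputable def bracket (k : ℤ) : ℝ := √(1 + (k : ℝ) ^ 2)

theorem one_le_bracket (k : ℤ) : 1 ≤ bracket k :=
  Real.one_le_sqrt.2 (le_add_of_nonneg_right (sq_nonneg _))

theorem bracket_pos (k : ℤ) : 0 < bracket k := zero_lt_one.trans_le (one_le_bracket k)

theorem abs_le_bracket (k : ℤ) : |(k : ℝ)| ≤ bracket k :=
  Real.abs_le_sqrt (le_add_of_nonneg_left zero_le_one)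

theorem bracket_le_two_mul_abs {k : ℤ} (hk : k ≠ 0) : bracket k ≤ 2 * |(k : ℝ)| := by
  have h1 : (1 : ℝ) ≤ |(k : ℝ)| := by exact_mod_cast Int.one_le_abs hk
  refine Real.sqrt_le_iff.2 ⟨by positivity, ?_⟩
  rw [mul_pow, sq_abs]
  nlinarith [sq_abs (k : ℝ)]

theorem bracket_le_add (k j : ℤ) : bracket k ≤ bracket (k - j) + bracket j := by
  have h1 := one_le_bracket (k - j)
  have h2 := one_le_bracket j
  have hsq (n : ℤ) : bracket n ^ 2 = 1 + (n : ℝ) ^ 2 := Real.sq_sqrt (by positivity)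
  have hmul : ((k - j : ℤ) : ℝ) * j ≤ bracket (k - j) * bracket j := by
    refine (le_abs_self _).trans ?_
    rw [abs_mul]
    exact mul_le_mul (abs_le_bracket _) (abs_le_bracket _) (abs_nonneg _) (bracket_pos _).le
  have hsq1 := hsq (k - j)
  have hsq2 := hsq j
  refine Real.sqrt_le_iff.2 ⟨by linarith, ?_⟩
  push_cast at hmul hsq1
  nlinarith

theorem bracket_rpow_le_add {σ : ℝ} (hσ : 0 ≤ σ) (k j : ℤ) :
    bracket k ^ σ ≤ 2 ^ σ * (bracket (k - j) ^ σ + bracket j ^ σ) := by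
  have hmax : bracket k ≤ 2 * max (bracket (k - j)) (bracket j) := by
    linarith [bracket_le_add k j, le_max_left (bracket (k - j)) (bracket j),
      le_max_right (bracket (k - j)) (bracket j)]
  have h1 := Real.rpow_nonneg (bracket_pos (k - j)).le σ
  have h2 := Real.rpow_nonneg (bracket_pos j).le σ
  calc bracket k ^ σ ≤ (2 * max (bracket (k - j)) (bracket j)) ^ σ :=
        Real.rpow_le_rpow (bracket_pos k).le hmax hσ
    _ = 2 ^ σ * max (bracket (k - j)) (bracket j) ^ σ :=
        Real.mul_rpow zero_le_two ((bracket_pos j).le.trans (le_max_right _ _))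
    _ ≤ 2 ^ σ * (bracket (k - j) ^ σ + bracket j ^ σ) := by
        gcongr
        rcases max_choice (bracket (k - j)) (bracket j) with h | h <;> rw [h] <;> linarith

end JapaneseBracket

section WeightedNorms

open MeasureTheory
open scoped ENNReal

/-- The norm `‖⟨k⟩^σ a(k)‖_{ℓ²}` of a sequence, possibly infinite. -/
noncomputable def weightedNorm (σ : ℝ) (a : ℤ → ℂ) : ℝ≥0∞ :=
  eLpNorm (fun k => bracket k ^ σ • a k) 2 .count

theorem norm_bracket_rpow_smul (σ : ℝ) (k : ℤ) (z : ℂ) :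
    ‖bracket k ^ σ • z‖ = bracket k ^ σ * ‖z‖ := by
  rw [norm_smul, Real.norm_of_nonneg (Real.rpow_nonneg (bracket_pos k).le σ)]

theorem enorm_bracket_rpow_smul_mul_le {σ : ℝ} (hσ : 0 ≤ σ) (k j : ℤ) (z w : ℂ) :
    ‖bracket k ^ σ • (z * w)‖ₑ ≤ ENNReal.ofReal (2 ^ σ) *
      (‖bracket (k - j) ^ σ • z‖ₑ * ‖w‖ₑ + ‖z‖ₑ * ‖bracket j ^ σ • w‖ₑ) := by
  have h : ‖bracket k ^ σ • (z * w)‖ ≤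
      2 ^ σ * (‖bracket (k - j) ^ σ • z‖ * ‖w‖ + ‖z‖ * ‖bracket j ^ σ • w‖) := by
    simp only [norm_bracket_rpow_smul, norm_mul]
    calc bracket k ^ σ * (‖z‖ * ‖w‖)
        ≤ 2 ^ σ * (bracket (k - j) ^ σ + bracket j ^ σ) * (‖z‖ * ‖w‖) := by
          gcongr
          exact bracket_rpow_le_add hσ k j
      _ = _ := by ring
  simp only [← ofReal_norm]
  rw [← ENNReal.ofReal_mul (norm_nonneg _), ← ENNReal.ofReal_mul (norm_nonneg _),
    ← ENNReal.ofReal_add (by positivity) (by positivity), ← ENNReal.ofReal_mul (by positivity)]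
  exact ENNReal.ofReal_le_ofReal h

theorem weightedNorm_ne_top_iff {σ : ℝ} {a : ℤ → ℂ} :
    weightedNorm σ a ≠ ∞ ↔ Summable fun k => (bracket k ^ σ * ‖a k‖) ^ 2 := by
  simp only [weightedNorm, eLpNorm_two_count_ne_top_iff, norm_bracket_rpow_smul]

theorem toReal_weightedNorm (σ : ℝ) (a : ℤ → ℂ) :
    (weightedNorm σ a).toReal = √(∑' k, (bracket k ^ σ * ‖a k‖) ^ 2) := by
  simp only [weightedNorm, toReal_eLpNorm_two_count, norm_bracket_rpow_smul]

theorem weightedNorm_zero_left (a : ℤ → ℂ) : weightedNorm 0 a = eLpNorm a 2 .count := by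
  simp only [weightedNorm, Real.rpow_zero, one_smul]

theorem weightedNorm_zero_right (σ : ℝ) : weightedNorm σ 0 = 0 := by
  simp [weightedNorm]

theorem weightedNorm_le_mul {σ τ : ℝ} {a b : ℤ → ℂ} {C : ℝ≥0∞}
    (h : ∀ k, ‖bracket k ^ σ • a k‖ₑ ≤ C * ‖bracket k ^ τ • b k‖ₑ) :
    weightedNorm σ a ≤ C * weightedNorm τ b :=
  eLpNorm_le_mul_eLpNorm_of_ae_le_mul'' 2 (measurable_of_countable _).aestronglyMeasurable
    (ae_of_all _ h)

theorem weightedNorm_mono {σ τ : ℝ} (h : σ ≤ τ) (a : ℤ → ℂ) :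
    weightedNorm σ a ≤ weightedNorm τ a := by
  refine eLpNorm_mono fun k => ?_
  rw [norm_bracket_rpow_smul, norm_bracket_rpow_smul]
  gcongr
  exact one_le_bracket k

theorem weightedNorm_add_le (σ : ℝ) (a b : ℤ → ℂ) :
    weightedNorm σ (a + b) ≤ weightedNorm σ a + weightedNorm σ b := by
  simp only [weightedNorm, Pi.add_apply, smul_add]
  exact eLpNorm_add_le (measurable_of_countable _).aestronglyMeasurable
    (measurable_of_countable _).aestronglyMeasurable one_le_two

theorem weightedNorm_sub_le (σ : ℝ) (a b : ℤ → ℂ) :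
    weightedNorm σ (a - b) ≤ weightedNorm σ a + weightedNorm σ b := by
  simp only [weightedNorm, Pi.sub_apply, smul_sub]
  exact eLpNorm_sub_le (measurable_of_countable _).aestronglyMeasurable
    (measurable_of_countable _).aestronglyMeasurable one_le_two

/-- On the Fourier side, the mean-zero primitive `∂⁻¹` of a mean-zero function. At `k = 0` the
division by zero produces the required zero mean. -/
noncomputable def primitive (u : ℤ → ℂ) (k : ℤ) : ℂ := u k / (Complex.I * k)

theorem primitive_apply_zero (u : ℤ → ℂ) : primitive u 0 = 0 := by simp [primitive]

theorem norm_primitive (u : ℤ → ℂ) (k : ℤ) : ‖primitive u k‖ = ‖u k‖ / |(k : ℝ)| := by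
  rw [primitive, norm_div, norm_mul, Complex.norm_I, one_mul, Complex.norm_intCast]

theorem primitive_eq_mul_primitive_one (u : ℤ → ℂ) (k : ℤ) :
    primitive u k = u k * primitive 1 k := by
  rw [primitive, primitive, Pi.one_apply, mul_one_div]

theorem I_mul_primitive {u : ℤ → ℂ} (hu : u 0 = 0) (k : ℤ) :
    Complex.I * k * primitive u k = u k := by
  rcases eq_or_ne k 0 with rfl | hk
  · simp [hu]
  · exact mul_div_cancel₀ _ (mul_ne_zero Complex.I_ne_zero (Int.cast_ne_zero.2 hk))

theorem primitive_I_mul {b : ℤ → ℂ} (hb : b 0 = 0) :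
    primitive (fun k => Complex.I * k * b k) = b := by
  funext k
  rcases eq_or_ne k 0 with rfl | hk
  · rw [primitive_apply_zero, hb]
  · exact mul_div_cancel_left₀ _ (mul_ne_zero Complex.I_ne_zero (Int.cast_ne_zero.2 hk))

theorem norm_bracket_rpow_smul_primitive_le (s : ℝ) (u : ℤ → ℂ) (k : ℤ) :
    ‖bracket k ^ s • primitive u k‖ ≤ 2 * ‖bracket k ^ (s - 1) • u k‖ := by
  rcases eq_or_ne k 0 with rfl | hk
  · rw [primitive_apply_zero, smul_zero, norm_zero]
    positivity
  have hk' : 0 < |(k : ℝ)| := abs_pos.2 (Int.cast_ne_zero.2 hk)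
  have hb := bracket_pos k
  rw [norm_bracket_rpow_smul, norm_bracket_rpow_smul, norm_primitive, Real.rpow_sub_one hb.ne',
    mul_div_assoc', div_mul_eq_mul_div, mul_div_assoc', div_le_div_iff₀ hk' hb]
  nlinarith [mul_le_mul_of_nonneg_left (bracket_le_two_mul_abs hk)
    (mul_nonneg (Real.rpow_nonneg hb.le s) (norm_nonneg (u k)))]

theorem weightedNorm_primitive_le (s : ℝ) (u : ℤ → ℂ) :
    weightedNorm s (primitive u) ≤ 2 * weightedNorm (s - 1) u := by
  refine weightedNorm_le_mul fun k => ?_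
  rw [← ofReal_norm, ← ofReal_norm, ← ENNReal.ofReal_ofNat 2, ← ENNReal.ofReal_mul zero_le_two]
  exact ENNReal.ofReal_le_ofReal (norm_bracket_rpow_smul_primitive_le s u k)

theorem weightedNorm_I_mul_le (s : ℝ) (b : ℤ → ℂ) :
    weightedNorm (s - 1) (fun k => Complex.I * k * b k) ≤ weightedNorm s b := by
  refine eLpNorm_mono fun k => ?_
  have hb := bracket_pos k
  rw [norm_bracket_rpow_smul, norm_bracket_rpow_smul, norm_mul, norm_mul, Complex.norm_I, one_mul,
    Complex.norm_intCast, ← mul_assoc]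
  gcongr
  calc bracket k ^ (s - 1) * |(k : ℝ)| ≤ bracket k ^ (s - 1) * bracket k := by
        gcongr
        exact abs_le_bracket k
    _ = bracket k ^ s := by rw [← Real.rpow_add_one hb.ne', sub_add_cancel]

theorem weightedNorm_primitive_one_ne_top {τ : ℝ} (hτ : τ < 1 / 2) :
    weightedNorm τ (primitive 1) ≠ ∞ := by
  rw [weightedNorm_ne_top_iff]
  have hsum : Summable fun k : ℤ => 4 * |(k : ℝ)| ^ (-(2 - 2 * τ)) :=
    (Real.summable_abs_int_rpow (by linarith)).mul_left 4
  refine hsum.of_nonneg_of_le (fun k => sq_nonneg _) fun k => ?_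
  rcases eq_or_ne k 0 with rfl | hk
  · rw [primitive_apply_zero, norm_zero, mul_zero, zero_pow two_ne_zero]
    positivity
  have hk' : 0 < |(k : ℝ)| := abs_pos.2 (Int.cast_ne_zero.2 hk)
  calc (bracket k ^ τ * ‖primitive 1 k‖) ^ 2 ≤ (2 * bracket k ^ (τ - 1)) ^ 2 := by
        have h := norm_bracket_rpow_smul_primitive_le τ 1 k
        rw [norm_bracket_rpow_smul, norm_bracket_rpow_smul, Pi.one_apply, norm_one, mul_one] at h
        have h0 := Real.rpow_nonneg (bracket_pos k).le τ
        gcongr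
    _ = 4 * bracket k ^ (-(2 - 2 * τ)) := by
        rw [mul_pow, ← Real.rpow_mul_natCast (bracket_pos k).le, Nat.cast_ofNat,
          show (τ - 1) * 2 = -(2 - 2 * τ) by ring]
        norm_num
    _ ≤ 4 * |(k : ℝ)| ^ (-(2 - 2 * τ)) := mul_le_mul_of_nonneg_left
        (Real.rpow_le_rpow_of_nonpos hk' (abs_le_bracket k) (by linarith)) (by norm_num)

end WeightedNorms

section Convolution

open MeasureTheory
open scoped ENNReal

/-- The convolution of sequences, which gives the Fourier coefficients of a product. -/
noncomputable def convolution (a b : ℤ → ℂ) (k : ℤ) : ℂ := ∑' j, a (k - j) * b j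

theorem convolution_comm (a b : ℤ → ℂ) : convolution a b = convolution b a := by
  funext k
  rw [convolution, convolution, ← (Equiv.subLeft k).tsum_eq]
  simp only [Equiv.subLeft_apply, sub_sub_cancel, mul_comm]

theorem convolution_neg {a b : ℤ → ℂ} (ha : ∀ k, a (-k) = starRingEnd ℂ (a k))
    (hb : ∀ k, b (-k) = starRingEnd ℂ (b k)) (k : ℤ) :
    convolution a b (-k) = starRingEnd ℂ (convolution a b k) := by
  rw [convolution, convolution, Complex.conj_tsum, ← (Equiv.neg ℤ).tsum_eq]
  simp only [Equiv.neg_apply, map_mul, ← ha, ← hb, sub_neg_eq_add, neg_sub, neg_add_eq_sub]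

theorem tsum_enorm_convolution_le (a b : ℤ → ℂ) (k : ℤ) :
    ∑' j, ‖a (k - j)‖ₑ * ‖b j‖ₑ ≤ eLpNorm a 2 .count * eLpNorm b 2 .count := by
  rw [← eLpNorm_two_count_comp_equiv (Equiv.subLeft k) a]
  exact tsum_enorm_mul_enorm_le _ b

theorem summable_convolution {a b : ℤ → ℂ} (ha : weightedNorm 0 a ≠ ∞) (hb : weightedNorm 0 b ≠ ∞)
    (k : ℤ) : Summable fun j => a (k - j) * b j := by
  rw [weightedNorm_zero_left] at ha hb
  refine .of_enorm (ne_top_of_le_ne_top (ENNReal.mul_ne_top ha hb) ?_)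
  simpa only [enorm_mul] using tsum_enorm_convolution_le a b k

theorem enorm_bracket_rpow_smul_convolution_le {σ : ℝ} (hσ : 0 ≤ σ) (a b : ℤ → ℂ) (k : ℤ) :
    ‖bracket k ^ σ • convolution a b k‖ₑ ≤
      2 * ENNReal.ofReal (2 ^ σ) * (weightedNorm σ a * weightedNorm σ b) := by
  set c := ENNReal.ofReal (2 ^ σ)
  have h0 (a : ℤ → ℂ) : eLpNorm a 2 .count ≤ weightedNorm σ a :=
    (weightedNorm_zero_left a).symm.le.trans (weightedNorm_mono hσ a)
  calc ‖bracket k ^ σ • convolution a b k‖ₑ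
      ≤ ∑' j, ‖bracket k ^ σ • (a (k - j) * b j)‖ₑ := by
        rw [convolution, ← tsum_const_smul'']
        exact enorm_tsum_le_tsum_enorm
    _ ≤ c * (∑' j, ‖bracket (k - j) ^ σ • a (k - j)‖ₑ * ‖b j‖ₑ +
          ∑' j, ‖a (k - j)‖ₑ * ‖bracket j ^ σ • b j‖ₑ) := by
        rw [← ENNReal.tsum_add, ← ENNReal.tsum_mul_left]
        exact ENNReal.tsum_le_tsum fun j => enorm_bracket_rpow_smul_mul_le hσ k j _ _
    _ ≤ c * (weightedNorm σ a * weightedNorm σ b + weightedNorm σ a * weightedNorm σ b) := by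
        gcongr
        · exact (tsum_enorm_convolution_le (fun k => bracket k ^ σ • a k) b k).trans
            (mul_le_mul_right (h0 b) _)
        · exact (tsum_enorm_convolution_le a (fun k => bracket k ^ σ • b k) k).trans
            (mul_le_mul_left (h0 a) _)
    _ = _ := by ring

theorem exists_weightedNorm_primitive_convolution_le {σ τ : ℝ} (hσ : 0 ≤ σ) (hτ : τ < 1 / 2) :
    ∃ C : ℝ≥0∞, C ≠ ∞ ∧ ∀ a b : ℤ → ℂ, weightedNorm (σ + τ) (primitive (convolution a b)) ≤
      C * (weightedNorm σ a * weightedNorm σ b) := by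
  refine ⟨2 * ENNReal.ofReal (2 ^ σ) * weightedNorm τ (primitive 1), ?_, fun a b => ?_⟩
  · exact ENNReal.mul_ne_top (by finiteness) (weightedNorm_primitive_one_ne_top hτ)
  rw [mul_right_comm]
  refine weightedNorm_le_mul fun k => ?_
  calc ‖bracket k ^ (σ + τ) • primitive (convolution a b) k‖ₑ
      = ‖bracket k ^ σ • convolution a b k‖ₑ * ‖bracket k ^ τ • primitive 1 k‖ₑ := by
        rw [primitive_eq_mul_primitive_one, ← enorm_mul, smul_mul_smul_comm,
          Real.rpow_add (bracket_pos k)]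
    _ ≤ _ := by
        gcongr
        exact enorm_bracket_rpow_smul_convolution_le hσ a b k

end Convolution

section SequenceSpace

open scoped ENNReal

theorem memℓp_two_iff_weightedNorm_ne_top {a : ℤ → ℂ} : Memℓp a 2 ↔ weightedNorm 0 a ≠ ∞ := by
  rw [weightedNorm_zero_left, eLpNorm_two_count_ne_top_iff,
    memℓp_gen_iff (ENNReal.toReal_ofNat 2 ▸ two_pos), ENNReal.toReal_ofNat]
  simp only [Real.rpow_two]

theorem weightedNorm_zero_lp (a : lp (fun _ : ℤ => ℂ) 2) : weightedNorm 0 a = ‖a‖ₑ := by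
  have h : weightedNorm 0 a ≠ ∞ := memℓp_two_iff_weightedNorm_ne_top.1 (lp.memℓp a)
  rw [← ofReal_norm, ← ENNReal.ofReal_toReal h, weightedNorm_zero_left, toReal_eLpNorm_two_count,
    lp.norm_eq_tsum_rpow (ENNReal.toReal_ofNat 2 ▸ two_pos)]
  simp only [ENNReal.toReal_ofNat, Real.rpow_two, Real.sqrt_eq_rpow]

/-- The real Hilbert space of Fourier coefficient sequences of real mean-zero `L²` functions on the
circle. -/
def RealSeq : Submodule ℝ (lp (fun _ : ℤ => ℂ) 2) where
  carrier := {a | a 0 = 0 ∧ ∀ k, a (-k) = starRingEnd ℂ (a k)}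
  add_mem' ha hb := ⟨by simp [ha.1, hb.1], fun k => by simp [ha.2 k, hb.2 k]⟩
  zero_mem' := ⟨rfl, fun k => by simp⟩
  smul_mem' c a ha := ⟨by simp [ha.1], fun k => by simp [ha.2 k]⟩

namespace RealSeq

theorem isClosed : IsClosed (RealSeq : Set (lp (fun _ : ℤ => ℂ) 2)) := by
  have h (k : ℤ) : Continuous fun a : lp (fun _ : ℤ => ℂ) 2 => a k :=
    (lp.lipschitzWith_one_eval 2 k).continuous
  have hinter : (RealSeq : Set (lp (fun _ : ℤ => ℂ) 2)) =
      {a | a 0 = 0} ∩ ⋂ k : ℤ, {a | a (-k) = starRingEnd ℂ (a k)} := by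
    ext a
    simp [RealSeq]
  rw [hinter]
  exact (isClosed_eq (h 0) continuous_const).inter
    (isClosed_iInter fun k => isClosed_eq (h _) (Complex.continuous_conj.comp (h k)))

instance : CompleteSpace RealSeq := isClosed.completeSpace_coe

theorem ext {a b : RealSeq} (h : ⇑a.1 = ⇑b.1) : a = b := Subtype.ext (lp.ext h)

theorem weightedNorm_zero_left (a : RealSeq) : weightedNorm 0 a.1 = ‖a‖ₑ := weightedNorm_zero_lp a.1

theorem weightedNorm_zero_ne_top (a : RealSeq) : weightedNorm 0 a.1 ≠ ∞ := by
  rw [weightedNorm_zero_left]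
  exact enorm_ne_top

theorem enorm_le_weightedNorm {s : ℝ} (hs : 0 ≤ s) (a : RealSeq) : ‖a‖ₑ ≤ weightedNorm s a.1 :=
  (weightedNorm_zero_left a).symm.le.trans (weightedNorm_mono hs a.1)

theorem hasSum_norm_sq (a : RealSeq) : HasSum (fun k => ‖a.1 k‖ ^ 2) (‖a‖ ^ 2) := by
  have h := lp.hasSum_norm (ENNReal.toReal_ofNat 2 ▸ two_pos) a.1
  simpa only [ENNReal.toReal_ofNat, Real.rpow_two, Submodule.coe_norm] using h

theorem exists_coe_eq {u : ℤ → ℂ} (hu : weightedNorm 0 u ≠ ∞) (hzero : u 0 = 0)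
    (hneg : ∀ k, u (-k) = starRingEnd ℂ (u k)) : ∃ a : RealSeq, ⇑a.1 = u :=
  ⟨⟨⟨u, memℓp_two_iff_weightedNorm_ne_top.2 hu⟩, hzero, hneg⟩, rfl⟩

theorem weightedNorm_zero_primitive_convolution_ne_top (a b : RealSeq) :
    weightedNorm 0 (primitive (convolution a.1 b.1)) ≠ ∞ := by
  obtain ⟨C, hC, h⟩ := exists_weightedNorm_primitive_convolution_le le_rfl one_half_pos
  have ha := weightedNorm_zero_ne_top a
  have hb := weightedNorm_zero_ne_top b
  have hab := h a.1 b.1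
  rw [add_zero] at hab
  exact ne_top_of_le_ne_top (by finiteness) hab

/-- The mean-zero primitive `∂⁻¹(v w - P₀(v w))` of a product, on the Fourier side. -/
noncomputable def primitiveMul (a b : RealSeq) : RealSeq :=
  ⟨⟨primitive (convolution a.1 b.1), memℓp_two_iff_weightedNorm_ne_top.2
    (weightedNorm_zero_primitive_convolution_ne_top a b)⟩, primitive_apply_zero _, fun k => by
      simp [primitive, convolution_neg a.2.2 b.2.2]⟩

theorem coe_primitiveMul (a b : RealSeq) :
    ⇑(primitiveMul a b).1 = primitive (convolution a.1 b.1) := rfl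

theorem primitiveMul_comm (a b : RealSeq) : primitiveMul a b = primitiveMul b a :=
  ext <| by rw [coe_primitiveMul, coe_primitiveMul, convolution_comm]

theorem add_primitiveMul (a a' b : RealSeq) :
    primitiveMul (a + a') b = primitiveMul a b + primitiveMul a' b := by
  refine ext (funext fun k => ?_)
  have h : convolution (a + a').1 b.1 k = convolution a.1 b.1 k + convolution a'.1 b.1 k := by
    have hb := weightedNorm_zero_ne_top b
    rw [convolution, convolution, convolution,
      ← (summable_convolution (weightedNorm_zero_ne_top a) hb k).tsum_add
        (summable_convolution (weightedNorm_zero_ne_top a') hb k)]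
    exact tsum_congr fun j => add_mul _ _ _
  rw [coe_primitiveMul, primitive, h, add_div]
  rfl

theorem smul_primitiveMul (c : ℝ) (a b : RealSeq) :
    primitiveMul (c • a) b = c • primitiveMul a b := by
  refine ext (funext fun k => ?_)
  have h : convolution (c • a).1 b.1 k = c * convolution a.1 b.1 k := by
    rw [convolution, convolution, ← tsum_mul_left]
    exact tsum_congr fun j => mul_assoc _ _ _
  rw [coe_primitiveMul, primitive, h, mul_div_assoc]
  rfl

theorem exists_norm_primitiveMul_le :
    ∃ C : ℝ, ∀ a b : RealSeq, ‖primitiveMul a b‖ ≤ C * ‖a‖ * ‖b‖ := by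
  obtain ⟨C, hC, h⟩ := exists_weightedNorm_primitive_convolution_le le_rfl one_half_pos
  refine ⟨C.toReal, fun a b => ?_⟩
  have hab := h a.1 b.1
  rw [add_zero, ← coe_primitiveMul, weightedNorm_zero_left, weightedNorm_zero_left,
    weightedNorm_zero_left] at hab
  simpa only [ENNReal.toReal_mul, toReal_enorm, mul_assoc] using
    ENNReal.toReal_mono (by finiteness) hab

/-- `primitiveMul` as a bounded bilinear map. -/
noncomputable def primitiveMulL : RealSeq →L[ℝ] RealSeq →L[ℝ] RealSeq :=
  LinearMap.mkContinuous₂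
    (LinearMap.mk₂ ℝ primitiveMul add_primitiveMul smul_primitiveMul
      (fun a b b' => by
        rw [primitiveMul_comm, add_primitiveMul, primitiveMul_comm b, primitiveMul_comm b'])
      (fun c a b => by rw [primitiveMul_comm, smul_primitiveMul, primitiveMul_comm b]))
    exists_norm_primitiveMul_le.choose exists_norm_primitiveMul_le.choose_spec

theorem coe_primitiveMulL (a b : RealSeq) :
    ⇑(primitiveMulL a b).1 = primitive (convolution a.1 b.1) := rfl

theorem primitiveMulL_comm (a b : RealSeq) : primitiveMulL a b = primitiveMulL b a :=
  primitiveMul_comm a b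

end RealSeq

end SequenceSpace

section ContinuousFunctions

open MeasureTheory Real

theorem exists_periodic_primitive {f : ℝ → ℝ} {a b : ℝ} (hf : Continuous f) (hab : a < b) :
    ∃ e : ℝ → ℝ, (∀ x, HasDerivAt e (f x - (b - a)⁻¹ * ∫ t in a..b, f t) x) ∧ e b = e a ∧
      ∫ x in a..b, e x = 0 := by
  have hba : b - a ≠ 0 := (sub_pos.2 hab).ne'
  have hmean {g : ℝ → ℝ} (hg : Continuous g) :
      ∫ x in a..b, (g x - (b - a)⁻¹ * ∫ t in a..b, g t) = 0 := by
    rw [intervalIntegral.integral_sub (hg.intervalIntegrable _ _) intervalIntegrable_const,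
      intervalIntegral.integral_const, smul_eq_mul, mul_inv_cancel_left₀ hba, sub_self]
  let F : ℝ → ℝ := fun x => ∫ t in a..x, (f t - (b - a)⁻¹ * ∫ t in a..b, f t)
  have hF (x : ℝ) : HasDerivAt F (f x - (b - a)⁻¹ * ∫ t in a..b, f t) x :=
    ((hf.sub continuous_const).integral_hasStrictDerivAt a x).hasDerivAt
  have hFc : Continuous F := continuous_iff_continuousAt.2 fun x => (hF x).continuousAt
  refine ⟨fun x => F x - (b - a)⁻¹ * ∫ t in a..b, F t, fun x => (hF x).sub_const _, ?_, hmean hFc⟩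
  simp only [F, hmean hf, intervalIntegral.integral_same]

theorem memLp_periodMeasure_of_continuous {f : ℝ → ℝ} (hf : Continuous f) :
    MemLp f 2 periodMeasure := by
  obtain ⟨C, hC⟩ := (isCompact_Icc (a := 0) (b := 2 * π)).exists_bound_of_continuousOn
    hf.continuousOn
  refine MemLp.of_bound hf.aestronglyMeasurable C ?_
  filter_upwards [ae_restrict_mem measurableSet_Ioc] with x hx
  exact hC x (Set.Ioc_subset_Icc_self hx)

theorem integrable_periodMeasure_of_continuous {f : ℝ → ℝ} (hf : Continuous f) :
    Integrable f periodMeasure :=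
  (memLp_periodMeasure_of_continuous hf).integrable one_le_two

namespace RealSeq

theorem exists_eq_realCoeff {f : ℝ → ℝ} (hf : MemLp f 2 periodMeasure)
    (hmean : realCoeff f 0 = 0) : ∃ a : RealSeq, ⇑a.1 = realCoeff f := by
  refine exists_coe_eq ?_ hmean (realCoeff_neg f)
  rw [Miura.weightedNorm_zero_left, eLpNorm_two_count_ne_top_iff]
  exact (hasSum_sq_norm_realCoeff hf).summable

variable {a b : RealSeq} {f g : ℝ → ℝ}

theorem norm_sq_eq_integral (hf : MemLp f 2 periodMeasure) (hfa : realCoeff f = a.1) :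
    ‖a‖ ^ 2 = (2 * π)⁻¹ * ∫ x in (0 : ℝ)..2 * π, f x ^ 2 :=
  (hasSum_norm_sq a).unique (hfa ▸ hasSum_sq_norm_realCoeff hf)

theorem integral_sq_eq (hf : MemLp f 2 periodMeasure) (hfa : realCoeff f = a.1) :
    ∫ x in (0 : ℝ)..2 * π, f x ^ 2 = 2 * π * ‖a‖ ^ 2 := by
  rw [norm_sq_eq_integral hf hfa, mul_inv_cancel_left₀ two_pi_pos.ne']

theorem integral_eq_zero (hfa : realCoeff f = a.1) : ∫ x in (0 : ℝ)..2 * π, f x = 0 := by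
  have hmean := realCoeff_zero f
  rw [hfa, a.2.1, eq_comm, Complex.ofReal_eq_zero] at hmean
  exact (mul_eq_zero.1 hmean).resolve_left (inv_ne_zero two_pi_pos.ne')

theorem realCoeff_add (hf : Continuous f) (hg : Continuous g) (hfa : realCoeff f = a.1)
    (hgb : realCoeff g = b.1) : realCoeff (fun x => f x + g x) = (a + b).1 := by
  ext k
  rw [Miura.realCoeff_add (integrable_periodMeasure_of_continuous hf)
    (integrable_periodMeasure_of_continuous hg), hfa, hgb]
  rfl

/-- The Fourier coefficient sequences of continuous mean-zero functions: the dense subset of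
`RealSeq` on which the a priori estimates are proved by calculus. -/
def continuousSeq : Set RealSeq := {a | ∃ f : ℝ → ℝ, Continuous f ∧ realCoeff f = a.1}

theorem exists_continuous_integral_sq_sub_le (hf : MemLp f 2 periodMeasure) {ε : ℝ} (hε : 0 < ε) :
    ∃ g : ℝ → ℝ, Continuous g ∧ ∫ x in (0 : ℝ)..2 * π, (f x - g x) ^ 2 ≤ ε := by
  obtain ⟨g, hg, -⟩ := MemLp.exists_boundedContinuous_integral_rpow_sub_le two_pos
    (by rwa [ENNReal.ofReal_ofNat]) hε
  refine ⟨g, g.continuous, ?_⟩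
  rw [intervalIntegral.integral_of_le two_pi_pos.le]
  simpa only [rpow_two, norm_eq_abs, sq_abs] using hg

theorem dense_continuousSeq : Dense continuousSeq := by
  intro a
  refine Metric.mem_closure_iff.2 fun ε hε => ?_
  obtain ⟨f, hf, hfa⟩ := exists_memLp_realCoeff_eq a.1 a.2.2
  obtain ⟨g, hg, hfg⟩ := exists_continuous_integral_sq_sub_le hf (pow_pos hε 2)
  have hgm := memLp_periodMeasure_of_continuous hg
  let m : ℝ := (2 * π)⁻¹ * ∫ x in (0 : ℝ)..2 * π, g x
  have hcoeff (k : ℤ) :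
      realCoeff (fun x => g x - m) k = realCoeff g k - if k = 0 then (m : ℂ) else 0 := by
    rw [realCoeff_sub (hgm.integrable one_le_two) (integrable_const m), realCoeff_const]
  have hmean : realCoeff (fun x => g x - m) 0 = 0 := by
    rw [hcoeff, if_pos rfl, realCoeff_zero, sub_self]
  obtain ⟨b, hb⟩ := exists_eq_realCoeff (hgm.sub (memLp_const m)) hmean
  refine ⟨b, ⟨_, hg.sub continuous_const, hb.symm⟩, ?_⟩
  have hle (k : ℤ) : ‖(a - b).1 k‖ ^ 2 ≤ ‖realCoeff (fun x => f x - g x) k‖ ^ 2 := by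
    rcases eq_or_ne k 0 with rfl | hk
    · rw [(a - b).2.1, norm_zero, zero_pow two_ne_zero]
      positivity
    · have hsub : (a - b).1 k = realCoeff f k - realCoeff (fun x => g x - m) k :=
        congrArg₂ (· - ·) (congrFun hfa k).symm (congrFun hb k)
      rw [hsub, hcoeff, if_neg hk, sub_zero, realCoeff_sub (hf.integrable one_le_two)
        (hgm.integrable one_le_two)]
  have hnorm := hasSum_le hle (hasSum_norm_sq (a - b)) (hasSum_sq_norm_realCoeff (hf.sub hgm))
  rw [dist_eq_norm]
  refine lt_of_pow_lt_pow_left₀ 2 hε.le ((hnorm.trans ?_).trans_lt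
    (mul_lt_of_lt_one_left (pow_pos hε 2) (inv_lt_one_of_one_lt₀ (a := 2 * π) ?_)))
  · exact mul_le_mul_of_nonneg_left hfg (by positivity)
  · linarith [pi_gt_three]

theorem exists_primitive_primitiveMulL (hf : Continuous f) (hg : Continuous g)
    (hfa : realCoeff f = a.1) (hgb : realCoeff g = b.1) :
    ∃ (e : ℝ → ℝ) (c : ℝ), c = (2 * π)⁻¹ * ∫ x in (0 : ℝ)..2 * π, f x * g x ∧
      (∀ x, HasDerivAt e (f x * g x - c) x) ∧ e (2 * π) = e 0 ∧
      ∫ x in (0 : ℝ)..2 * π, e x = 0 ∧ realCoeff e = (primitiveMulL a b).1 := by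
  obtain ⟨e, he, heper, hemean⟩ := exists_periodic_primitive (hf.mul hg) two_pi_pos
  simp only [Pi.mul_apply, sub_zero] at he
  set c : ℝ := (2 * π)⁻¹ * ∫ x in (0 : ℝ)..2 * π, f x * g x
  refine ⟨e, c, rfl, he, heper, hemean, funext fun k => ?_⟩
  rw [coe_primitiveMulL]
  rcases eq_or_ne k 0 with rfl | hk
  · rw [primitive_apply_zero, realCoeff_zero, hemean, mul_zero, Complex.ofReal_zero]
  · have hIk : Complex.I * k ≠ 0 := by simp [hk]
    have hconv := (hasSum_realCoeff_mul (memLp_periodMeasure_of_continuous hf)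
      (memLp_periodMeasure_of_continuous hg) k).tsum_eq
    rw [hfa, hgb] at hconv
    rw [primitive, convolution, hconv, eq_div_iff hIk, mul_comm,
      ← realCoeff_of_hasDerivAt he (by fun_prop) heper,
      realCoeff_sub (integrable_periodMeasure_of_continuous (by fun_prop)) (integrable_const c),
      realCoeff_const, if_neg hk, sub_zero]

end RealSeq

end ContinuousFunctions

section AprioriEstimates

open Real

namespace RealSeq

/-- The square of a Lipschitz constant for the inverse of `d ↦ d + ∂⁻¹(a d - P₀(a d))` on `L²`, as a
function of `r = ‖a‖`. -/
noncomputable def linearizedConst (r : ℝ) : ℝ :=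
  2 + 8 * (2 * π * (2 * π * r ^ 2)) * exp (2 * √(2 * π * (2 * π * r ^ 2)))

theorem norm_sq_le_linearized_of_continuous {a d : RealSeq} (ha : a ∈ continuousSeq)
    (hd : d ∈ continuousSeq) : ‖d‖ ^ 2 ≤ linearizedConst ‖a‖ * ‖d + primitiveMulL a d‖ ^ 2 := by
  obtain ⟨f, hf, hfa⟩ := ha
  obtain ⟨g, hg, hgd⟩ := hd
  obtain ⟨e, c, -, he, heper, hemean, hecoeff⟩ := exists_primitive_primitiveMulL hf hg hfa hgd
  have hec : Continuous e := continuous_iff_continuousAt.2 fun x => (he x).continuousAt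
  have h := integral_sq_le_of_linear_ode hf hg two_pi_pos he heper (integral_eq_zero hfa) hemean
    (integral_sq_eq (memLp_periodMeasure_of_continuous hf) hfa)
  rw [integral_sq_eq (memLp_periodMeasure_of_continuous hg) hgd,
    integral_sq_eq (memLp_periodMeasure_of_continuous (by fun_prop))
      (realCoeff_add hg hec hgd hecoeff), sub_zero, mul_left_comm] at h
  exact le_of_mul_le_mul_left h two_pi_pos

theorem continuous_linearizedConst : Continuous linearizedConst := by
  unfold linearizedConst
  fun_prop

theorem norm_sq_le_linearized (a d : RealSeq) :
    ‖d‖ ^ 2 ≤ linearizedConst ‖a‖ * ‖d + primitiveMulL a d‖ ^ 2 := by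
  refine isClosed_property2
    (p := fun a d => ‖d‖ ^ 2 ≤ linearizedConst ‖a‖ * ‖d + primitiveMulL a d‖ ^ 2)
    dense_continuousSeq.denseRange_val ?_
    (fun a d => norm_sq_le_linearized_of_continuous a.2 d.2) a d
  exact isClosed_le (continuous_snd.norm.pow 2)
    ((continuous_linearizedConst.comp continuous_fst.norm).mul
      ((continuous_snd.add primitiveMulL.continuous₂).norm.pow 2))

theorem exists_norm_le_linearized (R : ℝ) :
    ∃ C : ℝ, ∀ a d : RealSeq, ‖a‖ ≤ R → ‖d‖ ≤ C * ‖d + primitiveMulL a d‖ := by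
  refine ⟨√(linearizedConst R), fun a d ha => ?_⟩
  have hmono : linearizedConst ‖a‖ ≤ linearizedConst R := by
    unfold linearizedConst
    gcongr
  have hnonneg : 0 ≤ linearizedConst R := by
    unfold linearizedConst
    positivity
  refine le_of_sq_le_sq ?_ (by positivity)
  rw [mul_pow, sq_sqrt hnonneg]
  exact (norm_sq_le_linearized a d).trans (mul_le_mul_of_nonneg_right hmono (sq_nonneg _))

/-- The bound for `‖v‖ ^ 2` in terms of `r = ‖v + ∂⁻¹(v ^ 2 - P₀(v ^ 2))‖`. -/
noncomputable def riccatiBound (r : ℝ) : ℝ :=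
  2 * (2 * π * r ^ 2) * ((2 * π)⁻¹ + 4 * (2 * π * r ^ 2 + 1))

theorem norm_sq_le_riccatiBound (v : RealSeq) :
    ‖v‖ ^ 2 ≤ riccatiBound ‖v + primitiveMulL v v‖ := by
  have hcont : Continuous riccatiBound := by
    unfold riccatiBound
    fun_prop
  have hclosed : IsClosed {v : RealSeq | ‖v‖ ^ 2 ≤ riccatiBound ‖v + primitiveMulL v v‖} :=
    isClosed_le (by fun_prop) (hcont.comp (by fun_prop))
  refine closure_minimal ?_ hclosed (dense_continuousSeq v)
  rintro v ⟨f, hf, hfv⟩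
  obtain ⟨w, m, hm, hw, hwper, -, hwcoeff⟩ := exists_primitive_primitiveMulL hf hf hfv hfv
  have hwc : Continuous w := continuous_iff_continuousAt.2 fun x => (hw x).continuousAt
  simp only [← pow_two] at hw hm
  rw [← norm_sq_eq_integral (memLp_periodMeasure_of_continuous hf) hfv] at hm
  have h := le_of_riccati hf two_pi_pos hw hwper (integral_eq_zero hfv)
    (integral_sq_eq (memLp_periodMeasure_of_continuous (hf.add hwc))
      (realCoeff_add hf hwc hfv hwcoeff))
  rwa [hm, sub_zero] at h

theorem exists_norm_le_of_quadratic (R : ℝ) :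
    ∃ K : ℝ, ∀ v : RealSeq, ‖v + primitiveMulL v v‖ ≤ R → ‖v‖ ≤ K := by
  refine ⟨√(riccatiBound R), fun v hv => ?_⟩
  refine le_sqrt_of_sq_le ((norm_sq_le_riccatiBound v).trans ?_)
  unfold riccatiBound
  gcongr

end RealSeq

end AprioriEstimates

section Regularity

open RealSeq
open scoped ENNReal

/-- The Miura map in integrated form, `v ↦ v + ∂⁻¹(v² - P₀(v²))`, on the Fourier side. -/
noncomputable def quadMap (v : RealSeq) : RealSeq := v + primitiveMulL v v

theorem coe_quadMap (v : RealSeq) :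
    ⇑(quadMap v).1 = ⇑v.1 + primitive (convolution v.1 v.1) := rfl

theorem quadMap_zero : quadMap 0 = 0 := by simp [quadMap]

theorem quadMap_sub_quadMap (v w : RealSeq) :
    quadMap v - quadMap w = (v - w) + primitiveMulL (v + w) (v - w) :=
  quadratic_sub_quadratic primitiveMulL_comm v w

theorem quadMap_surjective : Function.Surjective quadMap :=
  surjective_quadratic primitiveMulL_comm exists_norm_le_linearized exists_norm_le_of_quadratic

theorem exists_norm_sub_le_quadMap (R : ℝ) :
    ∃ L : ℝ, ∀ v w, ‖quadMap v‖ ≤ R → ‖quadMap w‖ ≤ R → ‖v - w‖ ≤ L * ‖quadMap v - quadMap w‖ :=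
  exists_lipschitz_quadratic primitiveMulL_comm exists_norm_le_linearized
    exists_norm_le_of_quadratic R

theorem quadMap_injective : Function.Injective quadMap := by
  intro a b hab
  obtain ⟨L, hL⟩ := exists_norm_sub_le_quadMap ‖quadMap a‖
  have h := hL a b le_rfl (by rw [hab])
  rw [hab, sub_self, norm_zero, mul_zero] at h
  exact sub_eq_zero.1 (norm_le_zero_iff.1 h)

theorem weightedNorm_quadMap_ne_top {s : ℝ} (hs : 0 ≤ s) {v : RealSeq}
    (hv : weightedNorm s v.1 ≠ ∞) : weightedNorm s (quadMap v).1 ≠ ∞ := by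
  obtain ⟨C, hC, hconv⟩ := exists_weightedNorm_primitive_convolution_le hs one_half_pos
  have hprim := hconv v.1 v.1
  rw [add_zero] at hprim
  rw [coe_quadMap]
  exact ne_top_of_le_ne_top (by finiteness)
    ((weightedNorm_add_le s _ _).trans (add_le_add_right hprim _))

/-- The inverse of `quadMap` is Lipschitz on balls, measured in the norm of order `s` before and in
the norm of order `σ` after inversion. -/
def LipschitzInverse (s σ : ℝ) : Prop :=
  ∀ R : ℝ≥0∞, R ≠ ∞ → ∃ L : ℝ≥0∞, L ≠ ∞ ∧ ∀ v w : RealSeq,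
    weightedNorm s (quadMap v).1 ≤ R → weightedNorm s (quadMap w).1 ≤ R →
      weightedNorm σ (v - w).1 ≤ L * weightedNorm s (quadMap v - quadMap w).1

theorem lipschitzInverse_zero {s : ℝ} (hs : 0 ≤ s) : LipschitzInverse s 0 := by
  intro R hR
  obtain ⟨L, hL⟩ := exists_norm_sub_le_quadMap R.toReal
  have hnorm (v : RealSeq) (hv : weightedNorm s (quadMap v).1 ≤ R) : ‖quadMap v‖ ≤ R.toReal :=
    ENNReal.toReal_mono hR ((enorm_le_weightedNorm hs (quadMap v)).trans hv)
  refine ⟨ENNReal.ofReal L, ENNReal.ofReal_ne_top, fun v w hv hw => ?_⟩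
  calc weightedNorm 0 (v - w).1 = ENNReal.ofReal ‖v - w‖ := by
        rw [RealSeq.weightedNorm_zero_left, ofReal_norm]
    _ ≤ ENNReal.ofReal (L * ‖quadMap v - quadMap w‖) :=
        ENNReal.ofReal_le_ofReal (hL v w (hnorm v hv) (hnorm w hw))
    _ = ENNReal.ofReal L * ‖quadMap v - quadMap w‖ₑ := by
        rw [ENNReal.ofReal_mul' (norm_nonneg _), ofReal_norm]
    _ ≤ ENNReal.ofReal L * weightedNorm s (quadMap v - quadMap w).1 :=
        mul_le_mul_right (enorm_le_weightedNorm hs _) _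

namespace LipschitzInverse

theorem exists_weightedNorm_le {s σ : ℝ} (h : LipschitzInverse s σ) {R : ℝ≥0∞} (hR : R ≠ ∞) :
    ∃ K : ℝ≥0∞, K ≠ ∞ ∧ ∀ v : RealSeq, weightedNorm s (quadMap v).1 ≤ R →
      weightedNorm σ v.1 ≤ K := by
  obtain ⟨L, hL, hLip⟩ := h R hR
  refine ⟨L * R, ENNReal.mul_ne_top hL hR, fun v hv => ?_⟩
  have hzero : weightedNorm s (quadMap 0).1 ≤ R := by
    rw [quadMap_zero]
    exact (weightedNorm_zero_right s).trans_le zero_le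
  have hvL := hLip v 0 hv hzero
  rw [quadMap_zero, sub_zero, sub_zero] at hvL
  exact hvL.trans (mul_le_mul_right hv _)

theorem gain {s σ : ℝ} (hσ : 0 ≤ σ) (h : LipschitzInverse s σ) :
    LipschitzInverse s (min (σ + 1 / 4) s) := by
  intro R hR
  obtain ⟨L, hL, hLip⟩ := h R hR
  obtain ⟨K, hK, hbdd⟩ := h.exists_weightedNorm_le hR
  obtain ⟨C, hC, hconv⟩ :=
    exists_weightedNorm_primitive_convolution_le (τ := 1 / 4) hσ (by norm_num)
  refine ⟨1 + C * ((K + K) * L), by finiteness, fun v w hv hw => ?_⟩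
  set D := weightedNorm s (quadMap v - quadMap w).1
  have hdiff : ⇑(v - w).1 =
      ⇑(quadMap v - quadMap w).1 - primitive (convolution (v + w).1 (v - w).1) := by
    have hsub := (eq_sub_of_add_eq (quadMap_sub_quadMap v w).symm)
    conv_lhs => rw [hsub]
    rfl
  have hsum : weightedNorm σ (v + w).1 ≤ K + K :=
    (weightedNorm_add_le σ v.1 w.1).trans (add_le_add (hbdd v hv) (hbdd w hw))
  rw [hdiff]
  calc weightedNorm (min (σ + 1 / 4) s) (⇑(quadMap v - quadMap w).1 -
          primitive (convolution (v + w).1 (v - w).1))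
      ≤ weightedNorm (min (σ + 1 / 4) s) (quadMap v - quadMap w).1 +
          weightedNorm (min (σ + 1 / 4) s) (primitive (convolution (v + w).1 (v - w).1)) :=
        weightedNorm_sub_le _ _ _
    _ ≤ D + C * (weightedNorm σ (v + w).1 * weightedNorm σ (v - w).1) :=
        add_le_add (weightedNorm_mono (min_le_right _ _) _)
          ((weightedNorm_mono (min_le_left _ _) _).trans (hconv _ _))
    _ ≤ D + C * ((K + K) * (L * D)) := by
        gcongr
        exact hLip v w hv hw
    _ = (1 + C * ((K + K) * L)) * D := by ring

end LipschitzInverse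

theorem lipschitzInverse_self {s : ℝ} (hs : 0 ≤ s) : LipschitzInverse s s := by
  have h (n : ℕ) : LipschitzInverse s (min (n / 4) s) := by
    induction n with
    | zero => simpa [hs] using lipschitzInverse_zero hs
    | succ n ih =>
      have hstep : min (min ((n : ℝ) / 4) s + 1 / 4) s = min (((n + 1 : ℕ) : ℝ) / 4) s := by
        rw [← min_add_add_right, min_assoc, min_eq_right (by linarith : s ≤ s + 1 / 4),
          ← add_div, Nat.cast_succ]
      exact hstep ▸ ih.gain (le_min (by positivity) hs)
  obtain ⟨n, hn⟩ := exists_nat_ge (4 * s)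
  simpa only [min_eq_right (by linarith : s ≤ n / 4)] using h n

theorem weightedNorm_ne_top_of_quadMap {s : ℝ} (hs : 0 ≤ s) {v : RealSeq}
    (hv : weightedNorm s (quadMap v).1 ≠ ∞) : weightedNorm s v.1 ≠ ∞ := by
  obtain ⟨K, hK, hbdd⟩ := (lipschitzInverse_self hs).exists_weightedNorm_le hv
  exact ne_top_of_le_ne_top hK (hbdd v le_rfl)

end Regularity

section SobolevSpaces

open MeasureTheory Real
open scoped ENNReal

theorem sobolevNorm_eq (s : ℝ) (u : Distribution) :
    sobolevNorm s u = √(2 * π) * (weightedNorm s (fourierCoeff u)).toReal := by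
  rw [toReal_weightedNorm]
  rfl

theorem mem_sobolevZero_iff {s : ℝ} {u : Distribution} :
    u ∈ SobolevZero s ↔ weightedNorm s (fourierCoeff u) ≠ ∞ ∧ fourierCoeff u 0 = 0 := by
  rw [weightedNorm_ne_top_iff, ← P0_eq_zero_iff]
  rfl

theorem weightedNorm_fourierCoeff_sub_ne_top {s : ℝ} {u v : Distribution}
    (hu : u ∈ SobolevZero s) (hv : v ∈ SobolevZero s) :
    weightedNorm s (fourierCoeff (u - v)) ≠ ∞ := by
  rw [fourierCoeff_sub]
  exact ne_top_of_le_ne_top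
    (ENNReal.add_ne_top.2 ⟨(mem_sobolevZero_iff.1 hu).1, (mem_sobolevZero_iff.1 hv).1⟩)
    (weightedNorm_sub_le _ _ _)

theorem weightedNorm_fourierCoeff_le_of_sobolevNorm_sub_le {s R : ℝ} {u u₀ : Distribution}
    (hu : u ∈ SobolevZero s) (hu₀ : u₀ ∈ SobolevZero s) (h : sobolevNorm s (u - u₀) ≤ R) :
    weightedNorm s (fourierCoeff u) ≤ ENNReal.ofReal R + weightedNorm s (fourierCoeff u₀) := by
  have hpi : 1 ≤ √(2 * π) := one_le_sqrt.2 (by linarith [pi_gt_three])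
  have hsub : weightedNorm s (fourierCoeff (u - u₀)) ≤ ENNReal.ofReal R := by
    refine ENNReal.le_ofReal_iff_toReal_le (weightedNorm_fourierCoeff_sub_ne_top hu hu₀) ?_ |>.2 ?_
    · exact (mul_nonneg (sqrt_nonneg _) (sqrt_nonneg _)).trans h
    · rw [sobolevNorm_eq] at h
      exact (le_mul_of_one_le_left ENNReal.toReal_nonneg hpi).trans h
  calc weightedNorm s (fourierCoeff u)
      = weightedNorm s (fourierCoeff (u - u₀) + fourierCoeff u₀) := by
        rw [fourierCoeff_sub, sub_add_cancel]
    _ ≤ ENNReal.ofReal R + weightedNorm s (fourierCoeff u₀) :=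
        (weightedNorm_add_le s _ _).trans (add_le_add_left hsub _)

theorem sobolevNorm_le_of_weightedNorm_le {s σ : ℝ} {u v : Distribution} {C : ℝ≥0∞} (hC : C ≠ ∞)
    (hv : weightedNorm σ (fourierCoeff v) ≠ ∞)
    (h : weightedNorm s (fourierCoeff u) ≤ C * weightedNorm σ (fourierCoeff v)) :
    sobolevNorm s u ≤ C.toReal * sobolevNorm σ v := by
  have hreal := ENNReal.toReal_mono (ENNReal.mul_ne_top hC hv) h
  rw [ENNReal.toReal_mul] at hreal
  rw [sobolevNorm_eq, sobolevNorm_eq, mul_left_comm]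
  exact mul_le_mul_of_nonneg_left hreal (sqrt_nonneg _)

theorem exists_realSeq_eq_fourierCoeff {s : ℝ} (hs : 0 ≤ s) {v : Distribution}
    (hv : v ∈ SobolevZero s) : ∃ a : RealSeq, fourierCoeff v = a.1 := by
  obtain ⟨hfin, hmean⟩ := mem_sobolevZero_iff.1 hv
  obtain ⟨a, ha⟩ := RealSeq.exists_coe_eq
    (ne_top_of_le_ne_top hfin (weightedNorm_mono hs _)) hmean (fourierCoeff_neg v)
  exact ⟨a, ha.symm⟩

theorem exists_isL2Rep_fourierCoeff_eq (a : RealSeq) :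
    ∃ (v : Distribution) (f : ℝ → ℝ), IsL2Rep v f ∧ fourierCoeff v = a.1 := by
  obtain ⟨f, hf, hfa⟩ := exists_memLp_realCoeff_eq a.1 a.2.2
  have hint : IntegrableOn f (Set.Ioc 0 (2 * π)) := hf.integrable one_le_two
  exact ⟨ofFun f hint, f, ⟨hf, fun φ => rfl⟩, (fourierCoeff_ofFun hint).trans hfa⟩

theorem fourierCoeff_sq {v : Distribution} {a : RealSeq} (h : fourierCoeff v = a.1) :
    fourierCoeff (sq v) = convolution a.1 a.1 := by
  have hex : ∃ f, IsL2Rep v f := by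
    obtain ⟨w, f, hf, hw⟩ := exists_isL2Rep_fourierCoeff_eq a
    exact Distribution.ext_fourierCoeff (hw.trans h.symm) ▸ ⟨f, hf⟩
  obtain ⟨hmem, hrep⟩ := hex.choose_spec
  have hint : IntegrableOn (fun x => hex.choose x ^ 2) (Set.Ioc 0 (2 * π)) := hmem.integrable_sq
  have hsq : sq v = ofFun (fun x => hex.choose x ^ 2) hint := dif_pos hex
  have hcoeff : realCoeff hex.choose = a.1 :=
    (fourierCoeff_eq_realCoeff (hmem.integrable one_le_two) hrep).symm.trans h
  ext k
  have hconv := (hasSum_realCoeff_mul hmem hmem k).tsum_eq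
  rw [hcoeff] at hconv
  rw [hsq, fourierCoeff_ofFun hint, convolution, hconv]
  simp only [pow_two]

theorem fourierCoeff_miura {v : Distribution} {a : RealSeq} (h : fourierCoeff v = a.1) :
    fourierCoeff (miura v) = fun k => Complex.I * k * (quadMap a).1 k := by
  ext k
  rw [miura, fourierCoeff_sub, fourierCoeff_add, Pi.sub_apply, Pi.add_apply, fourierCoeff_dx,
    fourierCoeff_P0, fourierCoeff_sq h, h, coe_quadMap, Pi.add_apply]
  rcases eq_or_ne k 0 with rfl | hk
  · simp
  · have hIk : Complex.I * k ≠ 0 := by simp [hk]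
    rw [if_neg hk, sub_zero, mul_add, primitive, mul_div_cancel₀ _ hIk]

theorem coe_quadMap_eq_primitive {v : Distribution} {a : RealSeq} (h : fourierCoeff v = a.1) :
    ⇑(quadMap a).1 = primitive (fourierCoeff (miura v)) := by
  rw [fourierCoeff_miura h, primitive_I_mul (quadMap a).2.1]

end SobolevSpaces

section MiuraMap

open scoped ENNReal

variable {s : ℝ}

theorem miura_mapsTo (hs : 0 ≤ s) : Set.MapsTo miura (SobolevZero s) (SobolevZero (s - 1)) := by
  intro v hv
  obtain ⟨a, ha⟩ := exists_realSeq_eq_fourierCoeff hs hv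
  have hfin := (mem_sobolevZero_iff.1 hv).1
  rw [ha] at hfin
  rw [mem_sobolevZero_iff, fourierCoeff_miura ha]
  exact ⟨ne_top_of_le_ne_top (weightedNorm_quadMap_ne_top hs hfin) (weightedNorm_I_mul_le s _),
    by simp⟩

theorem miura_injOn (hs : 0 ≤ s) : Set.InjOn miura (SobolevZero s) := by
  intro v hv w hw hvw
  obtain ⟨a, ha⟩ := exists_realSeq_eq_fourierCoeff hs hv
  obtain ⟨b, hb⟩ := exists_realSeq_eq_fourierCoeff hs hw
  have hab : quadMap a = quadMap b := RealSeq.ext <| by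
    rw [coe_quadMap_eq_primitive ha, hvw, coe_quadMap_eq_primitive hb]
  exact Distribution.ext_fourierCoeff (ha.trans (quadMap_injective hab ▸ hb.symm))

theorem miura_surjOn (hs : 0 ≤ s) :
    Set.SurjOn miura (SobolevZero s) (SobolevZero (s - 1)) := by
  intro u hu
  obtain ⟨hfin, hmean⟩ := mem_sobolevZero_iff.1 hu
  have hprim : weightedNorm s (primitive (fourierCoeff u)) ≠ ∞ :=
    ne_top_of_le_ne_top (by finiteness) (weightedNorm_primitive_le s _)
  obtain ⟨b, hb⟩ := RealSeq.exists_coe_eq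
    (ne_top_of_le_ne_top hprim (weightedNorm_mono hs _)) (primitive_apply_zero _)
    fun k => by simp [primitive, fourierCoeff_neg]
  obtain ⟨a, rfl⟩ := quadMap_surjective b
  obtain ⟨v, -, -, hv⟩ := exists_isL2Rep_fourierCoeff_eq a
  refine ⟨v, mem_sobolevZero_iff.2 ?_, Distribution.ext_fourierCoeff ?_⟩
  · rw [hv]
    exact ⟨weightedNorm_ne_top_of_quadMap hs (hb ▸ hprim), a.2.1⟩
  · rw [fourierCoeff_miura hv, hb]
    exact funext (I_mul_primitive hmean)

theorem exists_weightedNorm_sub_le_miura (hs : 0 ≤ s) {R : ℝ≥0∞} (hR : R ≠ ∞) :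
    ∃ L : ℝ≥0∞, L ≠ ∞ ∧ ∀ v ∈ SobolevZero s, ∀ w ∈ SobolevZero s,
      weightedNorm (s - 1) (fourierCoeff (miura v)) ≤ R →
      weightedNorm (s - 1) (fourierCoeff (miura w)) ≤ R →
      weightedNorm s (fourierCoeff (v - w)) ≤
        L * weightedNorm (s - 1) (fourierCoeff (miura v - miura w)) := by
  obtain ⟨L, hL, hLip⟩ := lipschitzInverse_self hs (2 * R) (by finiteness)
  refine ⟨L * 2, by finiteness, fun v hv w hw hvR hwR => ?_⟩
  obtain ⟨a, ha⟩ := exists_realSeq_eq_fourierCoeff hs hv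
  obtain ⟨b, hb⟩ := exists_realSeq_eq_fourierCoeff hs hw
  have hball {v : Distribution} {a : RealSeq} (ha : fourierCoeff v = a.1)
      (h : weightedNorm (s - 1) (fourierCoeff (miura v)) ≤ R) :
      weightedNorm s (quadMap a).1 ≤ 2 * R := by
    rw [coe_quadMap_eq_primitive ha]
    exact (weightedNorm_primitive_le s _).trans (mul_le_mul_right h 2)
  have hdiff : ⇑(quadMap a - quadMap b).1 = primitive (fourierCoeff (miura v - miura w)) := by
    ext k
    change (quadMap a).1 k - (quadMap b).1 k = _
    rw [coe_quadMap_eq_primitive ha, coe_quadMap_eq_primitive hb, fourierCoeff_sub]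
    simp only [primitive, Pi.sub_apply, sub_div]
  calc weightedNorm s (fourierCoeff (v - w)) = weightedNorm s (a - b).1 := by
        rw [fourierCoeff_sub, ha, hb]
        rfl
    _ ≤ L * weightedNorm s (quadMap a - quadMap b).1 := hLip a b (hball ha hvR) (hball hb hwR)
    _ ≤ L * (2 * weightedNorm (s - 1) (fourierCoeff (miura v - miura w))) := by
        rw [hdiff]
        exact mul_le_mul_right (weightedNorm_primitive_le s _) L
    _ = L * 2 * weightedNorm (s - 1) (fourierCoeff (miura v - miura w)) := (mul_assoc _ _ _).symm

theorem exists_sobolevNorm_sub_le_miura (hs : 0 ≤ s) {u₀ : Distribution}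
    (hu₀ : u₀ ∈ SobolevZero (s - 1)) (R : ℝ) :
    ∃ L : ℝ, ∀ v ∈ SobolevZero s, ∀ w ∈ SobolevZero s,
      sobolevNorm (s - 1) (miura v - u₀) ≤ R → sobolevNorm (s - 1) (miura w - u₀) ≤ R →
        sobolevNorm s (v - w) ≤ L * sobolevNorm (s - 1) (miura v - miura w) := by
  have hfin := (mem_sobolevZero_iff.1 hu₀).1
  obtain ⟨L, hL, hLip⟩ := exists_weightedNorm_sub_le_miura hs
    (ENNReal.add_ne_top.2 ⟨ENNReal.ofReal_ne_top (r := R), hfin⟩)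
  refine ⟨L.toReal, fun v hv w hw hvR hwR => ?_⟩
  have hMv := miura_mapsTo hs hv
  have hMw := miura_mapsTo hs hw
  exact sobolevNorm_le_of_weightedNorm_le hL (weightedNorm_fourierCoeff_sub_ne_top hMv hMw)
    (hLip v hv w hw (weightedNorm_fourierCoeff_le_of_sobolevNorm_sub_le hMv hu₀ hvR)
      (weightedNorm_fourierCoeff_le_of_sobolevNorm_sub_le hMw hu₀ hwR))

end MiuraMap

end Miura

theorem mainTheorem5_general (s : ℝ) (hs : 0 ≤ s) :
    Set.BijOn Miura.miura (Miura.SobolevZero s) (Miura.SobolevZero (s - 1)) ∧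
    ∀ u₀ ∈ Miura.SobolevZero (s - 1), ∀ R : ℝ, ∃ L : ℝ,
      ∀ u₁ ∈ Miura.SobolevZero (s - 1), ∀ u₂ ∈ Miura.SobolevZero (s - 1),
        Miura.sobolevNorm (s - 1) (u₁ - u₀) ≤ R → Miura.sobolevNorm (s - 1) (u₂ - u₀) ≤ R →
          Miura.sobolevNorm s
              (Function.invFunOn Miura.miura (Miura.SobolevZero s) u₁ -
                Function.invFunOn Miura.miura (Miura.SobolevZero s) u₂) ≤
            L * Miura.sobolevNorm (s - 1) (u₁ - u₂) := by
  have hsurj := Miura.miura_surjOn hs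
  refine ⟨⟨Miura.miura_mapsTo hs, Miura.miura_injOn hs, hsurj⟩, fun u₀ hu₀ R => ?_⟩
  obtain ⟨L, hL⟩ := Miura.exists_sobolevNorm_sub_le_miura hs hu₀ R
  refine ⟨L, fun u₁ hu₁ u₂ hu₂ h₁ h₂ => ?_⟩
  have h := hL _ (Function.invFunOn_mem (hsurj hu₁)) _ (Function.invFunOn_mem (hsurj hu₂))
  rw [Function.invFunOn_eq (hsurj hu₁), Function.invFunOn_eq (hsurj hu₂)] at h
  exact h h₁ h₂

theorem mainTheorem5 (s : ℝ) (hs : 1 / 2 ≤ s) :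
    Set.BijOn Miura.miura (Miura.SobolevZero s) (Miura.SobolevZero (s - 1)) ∧
    ∀ u₀ ∈ Miura.SobolevZero (s - 1), ∀ R : ℝ, ∃ L : ℝ,
      ∀ u₁ ∈ Miura.SobolevZero (s - 1), ∀ u₂ ∈ Miura.SobolevZero (s - 1),
        Miura.sobolevNorm (s - 1) (u₁ - u₀) ≤ R → Miura.sobolevNorm (s - 1) (u₂ - u₀) ≤ R →
          Miura.sobolevNorm s
              (Function.invFunOn Miura.miura (Miura.SobolevZero s) u₁ -
                Function.invFunOn Miura.miura (Miura.SobolevZero s) u₂) ≤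
            L * Miura.sobolevNorm (s - 1) (u₁ - u₂) :=
  mainTheorem5_general s (by linarith)
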